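/- Let $\mathcal C$ be a braided monoidal category with braiding $\Psi$ (coherence isomorphisms are suppressed in formulas). A *Hopf algebra* in a braided category is a bialgebra $(H,\mu,\eta,\Delta,\varepsilon)$ together with an antipode $S:H\to H$, i.e. $\mu\circ(S\otimes\mathrm{id})\circ\Delta=\eta\circ\varepsilon=\mu\circ(\mathrm{id}\otimes S)\circ\Delta$, and $S$ is supposed to be an isomorphism. Let $A$ be a Hopf algebra in $\mathcal C$. A *right crossed module* over $A$ is an object $X$ of $\mathcal C$ with a right $A$-module structure $\triangleleft_X:X\otimes A\to X$ and a right $A$-comodule structure $\beta_X:X\to X\otimes A$ such that $$(\mathrm{id}_X\otimes\mu)\,(\Psi_{A,X}\otimes\mathrm{id}_A)\,(\mathrm{id}_A\otimes\beta_X\triangleleft_X)\,(\Psi_{X,A}\otimes\mathrm{id}_A)\,(\mathrm{id}_X\otimes\Delta)=(\triangleleft_X\otimes\mu)\,(\mathrm{id}_X\otimes\Psi_{A,A}\otimes\mathrm{id}_A)\,(\beta_X\otimes\Delta).$$ Right crossed modules, with the morphisms of $\mathcal C$ that are both module and comodule maps, form a braided monoidal category $\mathcal C_A^A$: $X\otimes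 Y$ has the action $(\triangleleft_X\otimes\triangleleft_Y)(\mathrm{id}_X\otimes\Psi_{Y,A}\otimes\mathrm{id}_A)(\mathrm{id}_{X\otimes Y}\otimes\Delta)$ and the coaction $(\mathrm{id}_{X\otimes Y}\otimes\mu)(\mathrm{id}_X\otimes\Psi_{A,Y}\otimes\mathrm{id}_A)(\beta_X\otimes\beta_Y)$, the unit object is that of $\mathcal C$ with trivial action and coaction, and the braiding is $${}^{(\mathcal C_A^A)}\Psi_{X,Y}=(\mathrm{id}_Y\otimes\triangleleft_X)\,(\Psi_{X,Y}\otimes\mathrm{id}_A)\,(\mathrm{id}_X\otimes\beta_Y):X\otimes Y\to Y\otimes X .$$ Let $A_{\rm ad}$ be the crossed module $A$ with the adjoint action $\mu\,(S\otimes\mu)\,(\Psi_{A,A}\otimes\mathrm{id}_A)\,(\mathrm{id}_A\otimes\Delta)$ and the coaction $\Delta$; with $\mu,\eta$ it is an algebra in $\mathcal C_A^A$. Let $A^{\rm ad}$ be the crossed module $A$ with the action $\mu$ and the coadjoint coaction $(\mathrm{id}_A\otimes\mu)\,(\Psi_{A,A}\otimes\mathrm{id}_A)\,(S\otimes\Delta)\,\Delta$;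 with $\Delta,\varepsilon$ it is a coalgebra in $\mathcal C_A^A$. **Theorem.** Let $A$ be a Hopf algebra in $\mathcal C$ and let $B$ be a Hopf algebra in the braided category $\mathcal C_A^A$, with antipodes $S_A$ and $S_B$. Then the object $A\otimes B$ of $\mathcal C$, with * the algebra structure underlying the tensor product algebra $A_{\rm ad}\,\underline{\otimes}\,B$ in $\mathcal C_A^A$, i.e. unit $\eta_A\otimes\eta_B$ and multiplication $(\mu_A\otimes\mu_B)\,(\mathrm{id}_A\otimes{}^{(\mathcal C_A^A)}\Psi_{B,A_{\rm ad}}\otimes\mathrm{id}_B)$, * the coalgebra structure underlying the tensor product coalgebra $A^{\rm ad}\,\underline{\otimes}\,B$ in $\mathcal C_A^A$, i.e. counit $\varepsilon_A\otimes\varepsilon_B$ and comultiplication $(\mathrm{id}_A\otimes{}^{(\mathcal C_A^A)}\Psi_{A^{\rm ad},B}\otimes\mathrm{id}_B)\,(\Delta_A\otimes\Delta_B)$, * the antipode ${}^{(\mathcal C_A^A)}\Psi_{B,A_{\rm ad}}\circ(S_B\otimes S_A)\circ{}^{(\mathcal C_A^A)}\Psi_{A^{\rm ad},B}$, is a Hopf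 algebra $A\ltimes B$ in $\mathcal C$; in particular its antipode is an isomorphism. -/

import Mathlib

set_option linter.unusedSimpArgs false
open CategoryTheory MonoidalCategory MonObj ComonObj HopfObj

namespace Strand

universe v u

section assoc

variable {C : Type u} [Category.{v} C]

lemma as21 {X Y1 Z R : C} {f0 : X ⟶ Y1} {f1 : Y1 ⟶ Z}
    {g0 : X ⟶ Z} (h : f0 ≫ f1 = g0) (r : Z ⟶ R) :
    f0 ≫ f1 ≫ r = g0 ≫ r := by
  simpa only [Category.assoc] using congrArg (fun t => t ≫ r) h

lemma as22 {X Y1 Z W1 R : C} {f0 : X ⟶ Y1} {f1 : Y1 ⟶ Z}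
    {g0 : X ⟶ W1} {g1 : W1 ⟶ Z} (h : f0 ≫ f1 = g0 ≫ g1) (r : Z ⟶ R) :
    f0 ≫ f1 ≫ r = g0 ≫ g1 ≫ r := by
  simpa only [Category.assoc] using congrArg (fun t => t ≫ r) h

lemma as23 {X Y1 Z W1 W2 R : C} {f0 : X ⟶ Y1} {f1 : Y1 ⟶ Z}
    {g0 : X ⟶ W1} {g1 : W1 ⟶ W2} {g2 : W2 ⟶ Z} (h : f0 ≫ f1 = g0 ≫ g1 ≫ g2) (r : Z ⟶ R) :
    f0 ≫ f1 ≫ r = g0 ≫ g1 ≫ g2 ≫ r := by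
  simpa only [Category.assoc] using congrArg (fun t => t ≫ r) h

lemma as32 {X Y1 Y2 Z W1 R : C} {f0 : X ⟶ Y1} {f1 : Y1 ⟶ Y2} {f2 : Y2 ⟶ Z}
    {g0 : X ⟶ W1} {g1 : W1 ⟶ Z} (h : f0 ≫ f1 ≫ f2 = g0 ≫ g1) (r : Z ⟶ R) :
    f0 ≫ f1 ≫ f2 ≫ r = g0 ≫ g1 ≫ r := by
  simpa only [Category.assoc] using congrArg (fun t => t ≫ r) h

lemma as33 {X Y1 Y2 Z W1 W2 R : C} {f0 : X ⟶ Y1} {f1 : Y1 ⟶ Y2} {f2 : Y2 ⟶ Z}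
    {g0 : X ⟶ W1} {g1 : W1 ⟶ W2} {g2 : W2 ⟶ Z} (h : f0 ≫ f1 ≫ f2 = g0 ≫ g1 ≫ g2) (r : Z ⟶ R) :
    f0 ≫ f1 ≫ f2 ≫ r = g0 ≫ g1 ≫ g2 ≫ r := by
  simpa only [Category.assoc] using congrArg (fun t => t ≫ r) h

lemma as24 {X Y1 Z W1 W2 W3 R : C} {f0 : X ⟶ Y1} {f1 : Y1 ⟶ Z}
    {g0 : X ⟶ W1} {g1 : W1 ⟶ W2} {g2 : W2 ⟶ W3} {g3 : W3 ⟶ Z} (h : f0 ≫ f1 = g0 ≫ g1 ≫ g2 ≫ g3) (r : Z ⟶ R) :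
    f0 ≫ f1 ≫ r = g0 ≫ g1 ≫ g2 ≫ g3 ≫ r := by
  simpa only [Category.assoc] using congrArg (fun t => t ≫ r) h

lemma as25 {X Y1 Z W1 W2 W3 W4 R : C} {f0 : X ⟶ Y1} {f1 : Y1 ⟶ Z}
    {g0 : X ⟶ W1} {g1 : W1 ⟶ W2} {g2 : W2 ⟶ W3} {g3 : W3 ⟶ W4} {g4 : W4 ⟶ Z} (h : f0 ≫ f1 = g0 ≫ g1 ≫ g2 ≫ g3 ≫ g4) (r : Z ⟶ R) :
    f0 ≫ f1 ≫ r = g0 ≫ g1 ≫ g2 ≫ g3 ≫ g4 ≫ r := by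
  simpa only [Category.assoc] using congrArg (fun t => t ≫ r) h

end assoc

section monoidal

variable {C : Type u} [Category.{v} C] [MonoidalCategory C]

lemma cancel_tail {X Y : C} {f g : X ⟶ Y} (h : ∀ Z : C, f ▷ Z = g ▷ Z) : f = g :=
  (whiskerRight_iff f g).1 (h _)

lemma wl21 (V : C) {X Y1 Z : C} {f0 : X ⟶ Y1} {f1 : Y1 ⟶ Z}
    {g0 : X ⟶ Z} (h : f0 ≫ f1 = g0) :
    V ◁ f0 ≫ V ◁ f1 = V ◁ g0 := by
  simpa only [whiskerLeft_comp] using congrArg (fun t => V ◁ t) h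

lemma wl22 (V : C) {X Y1 Z W1 : C} {f0 : X ⟶ Y1} {f1 : Y1 ⟶ Z}
    {g0 : X ⟶ W1} {g1 : W1 ⟶ Z} (h : f0 ≫ f1 = g0 ≫ g1) :
    V ◁ f0 ≫ V ◁ f1 = V ◁ g0 ≫ V ◁ g1 := by
  simpa only [whiskerLeft_comp] using congrArg (fun t => V ◁ t) h

lemma wl23 (V : C) {X Y1 Z W1 W2 : C} {f0 : X ⟶ Y1} {f1 : Y1 ⟶ Z}
    {g0 : X ⟶ W1} {g1 : W1 ⟶ W2} {g2 : W2 ⟶ Z} (h : f0 ≫ f1 = g0 ≫ g1 ≫ g2) :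
    V ◁ f0 ≫ V ◁ f1 = V ◁ g0 ≫ V ◁ g1 ≫ V ◁ g2 := by
  simpa only [whiskerLeft_comp] using congrArg (fun t => V ◁ t) h

lemma wl32 (V : C) {X Y1 Y2 Z W1 : C} {f0 : X ⟶ Y1} {f1 : Y1 ⟶ Y2} {f2 : Y2 ⟶ Z}
    {g0 : X ⟶ W1} {g1 : W1 ⟶ Z} (h : f0 ≫ f1 ≫ f2 = g0 ≫ g1) :
    V ◁ f0 ≫ V ◁ f1 ≫ V ◁ f2 = V ◁ g0 ≫ V ◁ g1 := by
  simpa only [whiskerLeft_comp] using congrArg (fun t => V ◁ t) h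

lemma wl33 (V : C) {X Y1 Y2 Z W1 W2 : C} {f0 : X ⟶ Y1} {f1 : Y1 ⟶ Y2} {f2 : Y2 ⟶ Z}
    {g0 : X ⟶ W1} {g1 : W1 ⟶ W2} {g2 : W2 ⟶ Z} (h : f0 ≫ f1 ≫ f2 = g0 ≫ g1 ≫ g2) :
    V ◁ f0 ≫ V ◁ f1 ≫ V ◁ f2 = V ◁ g0 ≫ V ◁ g1 ≫ V ◁ g2 := by
  simpa only [whiskerLeft_comp] using congrArg (fun t => V ◁ t) h

lemma wl25 (V : C) {X Y1 Z W1 W2 W3 W4 : C} {f0 : X ⟶ Y1} {f1 : Y1 ⟶ Z}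
    {g0 : X ⟶ W1} {g1 : W1 ⟶ W2} {g2 : W2 ⟶ W3} {g3 : W3 ⟶ W4} {g4 : W4 ⟶ Z} (h : f0 ≫ f1 = g0 ≫ g1 ≫ g2 ≫ g3 ≫ g4) :
    V ◁ f0 ≫ V ◁ f1 = V ◁ g0 ≫ V ◁ g1 ≫ V ◁ g2 ≫ V ◁ g3 ≫ V ◁ g4 := by
  simpa only [whiskerLeft_comp] using congrArg (fun t => V ◁ t) h

/-! Morphisms `f` on the first strands, next to a spectator object `Z`, in right-bracketed form. -/

def opM {X Y W : C} (f : X ⊗ Y ⟶ W) (Z : C) : X ⊗ (Y ⊗ Z) ⟶ W ⊗ Z := (α_ X Y Z).inv ≫ f ▷ Z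
def opD {X Y W : C} (f : W ⟶ X ⊗ Y) (Z : C) : W ⊗ Z ⟶ X ⊗ (Y ⊗ Z) := f ▷ Z ≫ (α_ X Y Z).hom
def opU {X : C} (f : 𝟙_ C ⟶ X) (Z : C) : Z ⟶ X ⊗ Z := (λ_ Z).inv ≫ f ▷ Z
def opE {X : C} (f : X ⟶ 𝟙_ C) (Z : C) : X ⊗ Z ⟶ Z := f ▷ Z ≫ (λ_ Z).hom

variable {X Y W Z Z' : C}

lemma opM_tail (f : X ⊗ Y ⟶ W) (t : Z ⟶ Z') :
    opM f Z ≫ W ◁ t = X ◁ Y ◁ t ≫ opM f Z' := by simp [opM, ← whisker_exchange]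
lemma opD_tail (f : W ⟶ X ⊗ Y) (t : Z ⟶ Z') :
    opD f Z ≫ X ◁ Y ◁ t = W ◁ t ≫ opD f Z' := by simp [opD, whisker_exchange_assoc]
lemma opU_tail (f : 𝟙_ C ⟶ X) (t : Z ⟶ Z') :
    opU f Z ≫ X ◁ t = t ≫ opU f Z' := by simp [opU, ← whisker_exchange]
lemma opE_tail (f : X ⟶ 𝟙_ C) (t : Z ⟶ Z') :
    opE f Z ≫ t = X ◁ t ≫ opE f Z' := by simp [opE, whisker_exchange_assoc]

lemma opS_tail  (f : X ⟶ W) (t : Z ⟶ Z') :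
    f ▷ Z ≫ W ◁ t = X ◁ t ≫ f ▷ Z' := (whisker_exchange f t).symm

end monoidal

section braided

variable {C : Type u} [Category.{v} C] [MonoidalCategory C] [BraidedCategory C]

def opB (X Y Z : C) : X ⊗ (Y ⊗ Z) ⟶ Y ⊗ (X ⊗ Z) :=
  (α_ X Y Z).inv ≫ (β_ X Y).hom ▷ Z ≫ (α_ Y X Z).hom
def opBi (X Y Z : C) : X ⊗ (Y ⊗ Z) ⟶ Y ⊗ (X ⊗ Z) :=
  (α_ X Y Z).inv ≫ (β_ Y X).inv ▷ Z ≫ (α_ Y X Z).hom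

variable {X Y W V Z Z' : C}

lemma opB_tail (t : Z ⟶ Z') :
    opB X Y Z ≫ Y ◁ X ◁ t = X ◁ Y ◁ t ≫ opB X Y Z' := by
  have := whisker_exchange (β_ X Y).hom t
  simp only [opB, Category.assoc]
  rw [← associator_naturality_right, ← reassoc_of% this, associator_inv_naturality_right_assoc]
lemma opBi_tail (t : Z ⟶ Z') :
    opBi X Y Z ≫ Y ◁ X ◁ t = X ◁ Y ◁ t ≫ opBi X Y Z' := by
  have := whisker_exchange (β_ Y X).inv t
  simp only [opBi, Category.assoc]
  rw [← associator_naturality_right, ← reassoc_of% this, associator_inv_naturality_right_assoc]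

lemma B_Bi : opB X Y Z ≫ opBi Y X Z = 𝟙 _ := by
  simp [opB, opBi]
lemma Bi_B : opBi X Y Z ≫ opB Y X Z = 𝟙 _ := by
  simp [opB, opBi]

lemma opB_tensor_left : opB (X ⊗ Y) V Z =
    (α_ X Y (V ⊗ Z)).hom ≫ X ◁ opB Y V Z ≫ opB X V (Y ⊗ Z) ≫ V ◁ (α_ X Y Z).inv := by
  simp only [opB, BraidedCategory.braiding_tensor_left_hom]; monoidal
lemma opB_tensor_right : opB V (X ⊗ Y) Z =
    V ◁ (α_ X Y Z).hom ≫ opB V X (Y ⊗ Z) ≫ X ◁ opB V Y Z ≫ (α_ X Y (V ⊗ Z)).inv := by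
  simp only [opB, BraidedCategory.braiding_tensor_right_hom]; monoidal
lemma opB_unit_left : opB (𝟙_ C) V Z = (λ_ _).hom ≫ V ◁ (λ_ Z).inv := by
  simp [opB, braiding_tensorUnit_left]
lemma opB_unit_right : opB V (𝟙_ C) Z = V ◁ (λ_ _).hom ≫ (λ_ _).inv := by
  simp [opB, braiding_tensorUnit_right]

lemma opS_B (f : X ⟶ W) : f ▷ (V ⊗ Z) ≫ opB W V Z = opB X V Z ≫ V ◁ f ▷ Z := by
  simp only [opB, Category.assoc]
  rw [associator_inv_naturality_left_assoc, ← comp_whiskerRight_assoc,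
    BraidedCategory.braiding_naturality_left, comp_whiskerRight_assoc,
    associator_naturality_middle]
lemma B_opS (f : X ⟶ W) : V ◁ f ▷ Z ≫ opB V W Z = opB V X Z ≫ f ▷ (V ⊗ Z) := by
  simp only [opB, Category.assoc]
  rw [associator_inv_naturality_middle_assoc, ← comp_whiskerRight_assoc,
    BraidedCategory.braiding_naturality_right, comp_whiskerRight_assoc,
    associator_naturality_left]

lemma opM_B (f : X ⊗ Y ⟶ W) :
    opM f (V ⊗ Z) ≫ opB W V Z = X ◁ opB Y V Z ≫ opB X V (Y ⊗ Z) ≫ V ◁ opM f Z := by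
  rw [opM, Category.assoc, opS_B, opB_tensor_left]; simp [opM]
lemma B_opM (f : X ⊗ Y ⟶ W) :
    V ◁ opM f Z ≫ opB V W Z = opB V X (Y ⊗ Z) ≫ X ◁ opB V Y Z ≫ opM f (V ⊗ Z) := by
  rw [opM, whiskerLeft_comp, Category.assoc, B_opS, opB_tensor_right]; simp [opM]
lemma opD_B (f : W ⟶ X ⊗ Y) :
    opD f (V ⊗ Z) ≫ X ◁ opB Y V Z ≫ opB X V (Y ⊗ Z) = opB W V Z ≫ V ◁ opD f Z := by
  have := opS_B (V := V) (Z := Z) f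
  simp only [opB_tensor_left] at this
  simp only [opD, Category.assoc, whiskerLeft_comp]
  rw [← reassoc_of% this]; simp
lemma B_opD (f : W ⟶ X ⊗ Y) :
    V ◁ opD f Z ≫ opB V X (Y ⊗ Z) ≫ X ◁ opB V Y Z = opB V W Z ≫ opD f (V ⊗ Z) := by
  have := B_opS (V := V) (Z := Z) f
  simp only [opB_tensor_right] at this
  simp only [opD, Category.assoc, whiskerLeft_comp]
  rw [← reassoc_of% this]; simp
lemma opU_B (f : 𝟙_ C ⟶ X) : opU f (V ⊗ Z) ≫ opB X V Z = V ◁ opU f Z := by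
  rw [opU, Category.assoc, opS_B, opB_unit_left]; simp [opU]
lemma B_opU (f : 𝟙_ C ⟶ X) : V ◁ opU f Z ≫ opB V X Z = opU f (V ⊗ Z) := by
  rw [opU, whiskerLeft_comp, Category.assoc, B_opS, opB_unit_right]; simp [opU]
lemma B_opE (f : X ⟶ 𝟙_ C) : opB X V Z ≫ V ◁ opE f Z = opE f (V ⊗ Z) := by
  have := opS_B (V := V) (Z := Z) f
  simp only [opB_unit_left] at this
  simp only [opE, whiskerLeft_comp]
  rw [← reassoc_of% this]; simp
lemma opE_B (f : X ⟶ 𝟙_ C) : opB V X Z ≫ opE f (V ⊗ Z) = V ◁ opE f Z := by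
  have := B_opS (V := V) (Z := Z) f
  simp only [opB_unit_right] at this
  simp only [opE, whiskerLeft_comp]
  rw [← reassoc_of% this]; simp
lemma opB_B : opB X Y (V ⊗ Z) ≫ Y ◁ opB X V Z ≫ opB Y V (X ⊗ Z) =
    X ◁ opB Y V Z ≫ opB X V (Y ⊗ Z) ≫ V ◁ opB X Y Z := by
  have := opD_B (V := V) (Z := Z) ((β_ X Y).hom)
  have h : ∀ Z, opB X Y Z = (α_ X Y Z).inv ≫ opD (β_ X Y).hom Z := fun Z => by simp [opB, opD]
  rw [h (V ⊗ Z), h Z, Category.assoc, this, opB_tensor_left]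
  simp

end braided
end Strand

namespace Strand
universe v u
variable {C : Type u} [Category.{v} C] [MonoidalCategory C]

lemma act_unit_iff {X A : C} (η' : 𝟙_ C ⟶ A) (f : X ⊗ A ⟶ X) :
    X ◁ η' ≫ f = (ρ_ X).hom ↔ ∀ Z, X ◁ opU η' Z ≫ opM f Z = 𝟙 (X ⊗ Z) := by
  have key : ∀ Z, X ◁ opU η' Z ≫ opM f Z = (ρ_ X).inv ▷ Z ≫ (X ◁ η' ≫ f) ▷ Z := fun Z => by
    simp [opU, opM]
  constructor
  · intro h Z
    rw [key, h]; simp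
  · intro h
    refine cancel_tail fun Z => ?_
    have := h Z
    rw [key] at this
    rw [← cancel_epi ((ρ_ X).inv ▷ Z), this]; simp

lemma act_assoc_iff {X A : C} (m : A ⊗ A ⟶ A) (f : X ⊗ A ⟶ X) :
    f ▷ A ≫ f = (α_ X A A).hom ≫ X ◁ m ≫ f ↔
      ∀ Z, opM f (A ⊗ Z) ≫ opM f Z = X ◁ opM m Z ≫ opM f Z := by
  have h1 : ∀ Z, opM f (A ⊗ Z) ≫ opM f Z =
      (α_ X A (A ⊗ Z)).inv ≫ (α_ (X ⊗ A) A Z).inv ≫ (f ▷ A ≫ f) ▷ Z := fun Z => by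
    simp [opM]
  have h2 : ∀ Z, X ◁ opM m Z ≫ opM f Z =
      (α_ X A (A ⊗ Z)).inv ≫ (α_ (X ⊗ A) A Z).inv ≫ ((α_ X A A).hom ≫ X ◁ m ≫ f) ▷ Z :=
    fun Z => by simp [opM]
  simp only [h1, h2, cancel_epi]
  exact ⟨fun h Z => by rw [h], cancel_tail⟩

lemma coact_counit_iff {X A : C} (e : A ⟶ 𝟙_ C) (f : X ⟶ X ⊗ A) :
    f ≫ X ◁ e = (ρ_ X).inv ↔ ∀ Z, opD f Z ≫ X ◁ opE e Z = 𝟙 (X ⊗ Z) := by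
  have key : ∀ Z, opD f Z ≫ X ◁ opE e Z = (f ≫ X ◁ e) ▷ Z ≫ (ρ_ X).hom ▷ Z := fun Z => by
    simp [opE, opD]
  constructor
  · intro h Z
    rw [key, h]; simp
  · intro h
    refine cancel_tail fun Z => ?_
    have := h Z
    rw [key] at this
    rw [← cancel_mono ((ρ_ X).hom ▷ Z), this]; simp

lemma coact_coassoc_iff {X A : C} (d : A ⟶ A ⊗ A) (f : X ⟶ X ⊗ A) :
    f ≫ X ◁ d = f ≫ f ▷ A ≫ (α_ X A A).hom ↔
      ∀ Z, opD f Z ≫ X ◁ opD d Z = opD f Z ≫ opD f (A ⊗ Z) := by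
  have h1 : ∀ Z, opD f Z ≫ opD f (A ⊗ Z) =
      (f ≫ f ▷ A ≫ (α_ X A A).hom) ▷ Z ≫ (α_ X (A ⊗ A) Z).hom ≫ X ◁ (α_ A A Z).hom := fun Z => by
    simp [opD]
  have h2 : ∀ Z, opD f Z ≫ X ◁ opD d Z =
      (f ≫ X ◁ d) ▷ Z ≫ (α_ X (A ⊗ A) Z).hom ≫ X ◁ (α_ A A Z).hom :=
    fun Z => by simp [opD]
  simp only [h1, h2, cancel_mono]
  exact ⟨fun h Z => by rw [h], cancel_tail⟩

lemma actHom_iff {X Y A : C} (f : X ⊗ A ⟶ X) (f' : Y ⊗ A ⟶ Y) (g : X ⟶ Y) :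
    f ≫ g = g ▷ A ≫ f' ↔ ∀ Z, opM f Z ≫ g ▷ Z = g ▷ (A ⊗ Z) ≫ opM f' Z := by
  have h1 : ∀ Z, opM f Z ≫ g ▷ Z = (α_ X A Z).inv ≫ (f ≫ g) ▷ Z := fun Z => by simp [opM]
  have h2 : ∀ Z, g ▷ (A ⊗ Z) ≫ opM f' Z = (α_ X A Z).inv ≫ (g ▷ A ≫ f') ▷ Z :=
    fun Z => by simp [opM]
  simp only [h1, h2, cancel_epi]
  exact ⟨fun h Z => by rw [h], cancel_tail⟩

lemma coactHom_iff {X Y A : C} (r : X ⟶ X ⊗ A) (r' : Y ⟶ Y ⊗ A) (g : X ⟶ Y) :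
    g ≫ r' = r ≫ g ▷ A ↔ ∀ Z, g ▷ Z ≫ opD r' Z = opD r Z ≫ g ▷ (A ⊗ Z) := by
  have h1 : ∀ Z, g ▷ Z ≫ opD r' Z = (g ≫ r') ▷ Z ≫ (α_ Y A Z).hom := fun Z => by simp [opD]
  have h2 : ∀ Z, opD r Z ≫ g ▷ (A ⊗ Z) = (r ≫ g ▷ A) ▷ Z ≫ (α_ Y A Z).hom :=
    fun Z => by simp [opD]
  simp only [h1, h2, cancel_mono]
  exact ⟨fun h Z => by rw [h], cancel_tail⟩

variable [BraidedCategory C]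

lemma compat_iff {X A : C} (m : A ⊗ A ⟶ A) (d : A ⟶ A ⊗ A) (f : X ⊗ A ⟶ X) (r : X ⟶ X ⊗ A) :
    X ◁ d ≫ (α_ X A A).inv ≫ (β_ X A).hom ▷ A ≫ (α_ A X A).hom ≫ A ◁ f ≫ A ◁ r ≫
        (α_ A X A).inv ≫ (β_ A X).hom ▷ A ≫ (α_ X A A).hom ≫ X ◁ m =
      (r ⊗ₘ d) ≫ tensorμ X A A A ≫ (f ⊗ₘ m) ↔
    ∀ Z, X ◁ opD d Z ≫ opB X A (A ⊗ Z) ≫ A ◁ opM f Z ≫ A ◁ opD r Z ≫ opB A X (A ⊗ Z) ≫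
        X ◁ opM m Z =
      X ◁ opD d Z ≫ opD r (A ⊗ A ⊗ Z) ≫ X ◁ opB A A (A ⊗ Z) ≫ opM f (A ⊗ A ⊗ Z) ≫
        X ◁ opM m Z := by
  have h1 : ∀ Z, X ◁ opD d Z ≫ opB X A (A ⊗ Z) ≫ A ◁ opM f Z ≫ A ◁ opD r Z ≫
      opB A X (A ⊗ Z) ≫ X ◁ opM m Z = (α_ X A Z).inv ≫
      (X ◁ d ≫ (α_ X A A).inv ≫ (β_ X A).hom ▷ A ≫ (α_ A X A).hom ≫ A ◁ f ≫ A ◁ r ≫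
        (α_ A X A).inv ≫ (β_ A X).hom ▷ A ≫ (α_ X A A).hom ≫ X ◁ m) ▷ Z ≫ (α_ X A Z).hom := by
    intro Z
    simp only [opD, opB, opM]
    monoidal
  have h2 : ∀ Z, X ◁ opD d Z ≫ opD r (A ⊗ A ⊗ Z) ≫ X ◁ opB A A (A ⊗ Z) ≫ opM f (A ⊗ A ⊗ Z) ≫
        X ◁ opM m Z = (α_ X A Z).inv ≫
      ((r ⊗ₘ d) ≫ tensorμ X A A A ≫ (f ⊗ₘ m)) ▷ Z ≫ (α_ X A Z).hom := by
    intro Z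
    rw [tensorHom_def f, tensorHom_def' r]
    simp only [opD, opB, opM, tensorμ]
    monoidal
  simp only [h1, h2, cancel_epi, cancel_mono]
  exact ⟨fun h Z => by rw [h], cancel_tail⟩

lemma bialg {A : C} [BimonObj A] (Z : C) : opM μ[A] Z ≫ opD Δ[A] Z =
    A ◁ opD Δ Z ≫ opD Δ (A ⊗ A ⊗ Z) ≫ A ◁ opB A A (A ⊗ Z) ≫ opM μ (A ⊗ A ⊗ Z) ≫
      A ◁ opM μ Z := by
  have h1 : opM μ[A] Z ≫ opD Δ[A] Z = (α_ A A Z).inv ≫ (μ[A] ≫ Δ[A]) ▷ Z ≫ (α_ A A Z).hom := by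
    simp only [opD, opM, comp_whiskerRight, Category.assoc]
  rw [h1, BimonObj.mul_comul, tensorHom_def μ[A], tensorHom_def' Δ[A]]
  simp only [opD, opB, opM, tensorμ]
  monoidal

end Strand

universe v u

/-- A right crossed module over a bialgebra `A` in a braided category: an object with a right
`A`-module structure and a right `A`-comodule structure, subject to the compatibility axiom which
in elements reads `(x ◁ h₂)₀ ⊗ h₁ (x ◁ h₂)₁ = x₀ ◁ h₁ ⊗ x₁ h₂`. -/
structure CrossedModule {C : Type u} [Category.{v} C] [MonoidalCategory C] [BraidedCategory C]
    (A : C) [BimonObj A] where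
  X : C
  act : X ⊗ A ⟶ X
  coact : X ⟶ X ⊗ A
  act_one : X ◁ η[A] ≫ act = (ρ_ X).hom
  act_mul : act ▷ A ≫ act = (α_ X A A).hom ≫ X ◁ μ[A] ≫ act
  coact_counit : coact ≫ X ◁ ε[A] = (ρ_ X).inv
  coact_comul : coact ≫ X ◁ Δ[A] = coact ≫ coact ▷ A ≫ (α_ X A A).hom
  compatibility :
    X ◁ Δ[A] ≫ (α_ X A A).inv ≫ (β_ X A).hom ▷ A ≫ (α_ A X A).hom ≫ A ◁ act ≫ A ◁ coact ≫
        (α_ A X A).inv ≫ (β_ A X).hom ▷ A ≫ (α_ X A A).hom ≫ X ◁ μ[A] =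
      (coact ⊗ₘ Δ[A]) ≫ tensorμ X A A A ≫ (act ⊗ₘ μ[A])

namespace CrossedModule

open Strand

variable {C : Type u} [Category.{v} C] [MonoidalCategory C] [BraidedCategory C]
variable {A : C} [BimonObj A]

section rn
variable (X : CrossedModule A) (Z : C)
lemma rn_one : X.X ◁ opU η Z ≫ opM X.act Z = 𝟙 _ := (act_unit_iff _ _).1 X.act_one Z
lemma rn_mul : opM X.act (A ⊗ Z) ≫ opM X.act Z = X.X ◁ opM μ Z ≫ opM X.act Z :=
  (act_assoc_iff _ _).1 X.act_mul Z
lemma rn_counit : opD X.coact Z ≫ X.X ◁ opE ε Z = 𝟙 _ :=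
  (coact_counit_iff _ _).1 X.coact_counit Z
lemma rn_comul : opD X.coact Z ≫ X.X ◁ opD Δ Z = opD X.coact Z ≫ opD X.coact (A ⊗ Z) :=
  (coact_coassoc_iff _ _).1 X.coact_comul Z
lemma rn_compat : X.X ◁ opD Δ Z ≫ opB X.X A (A ⊗ Z) ≫ A ◁ opM X.act Z ≫ A ◁ opD X.coact Z ≫
      opB A X.X (A ⊗ Z) ≫ X.X ◁ opM μ Z =
    X.X ◁ opD Δ Z ≫ opD X.coact (A ⊗ A ⊗ Z) ≫ X.X ◁ opB A A (A ⊗ Z) ≫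
      opM X.act (A ⊗ A ⊗ Z) ≫ X.X ◁ opM μ Z := (compat_iff _ _ _ _).1 X.compatibility Z
end rn

/-- The diagonal action of `A` on a tensor product: `(x ⊗ y) ◁ h = (x ◁ h₁) ⊗ (y ◁ h₂)`. -/
def tensorAct (X Y : CrossedModule A) : (X.X ⊗ Y.X) ⊗ A ⟶ X.X ⊗ Y.X :=
  (X.X ⊗ Y.X) ◁ Δ[A] ≫ tensorμ X.X Y.X A A ≫ (X.act ⊗ₘ Y.act)

/-- The diagonal coaction on a tensor product: `x ⊗ y ↦ x₀ ⊗ y₀ ⊗ x₁ y₁`. -/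
def tensorCoact (X Y : CrossedModule A) : X.X ⊗ Y.X ⟶ (X.X ⊗ Y.X) ⊗ A :=
  (X.coact ⊗ₘ Y.coact) ≫ tensorμ X.X A Y.X A ≫ (X.X ⊗ Y.X) ◁ μ[A]

/-- The morphism underlying the braiding of crossed modules: `y ⊗ x ↦ x₀ ⊗ (y ◁ x₁)`. -/
def braid (Y X : CrossedModule A) : Y.X ⊗ X.X ⟶ X.X ⊗ Y.X :=
  Y.X ◁ X.coact ≫ (α_ Y.X X.X A).inv ≫ (β_ Y.X X.X).hom ▷ A ≫ (α_ X.X Y.X A).hom ≫ X.X ◁ Y.act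

/-- The action on `X ⊗ Y` in right-bracketed form, next to a spectator object `Z`. -/
def tA (X Y : CrossedModule A) (Z : C) : X.X ⊗ Y.X ⊗ A ⊗ Z ⟶ X.X ⊗ Y.X ⊗ Z :=
  X.X ◁ Y.X ◁ opD Δ Z ≫ X.X ◁ opB Y.X A (A ⊗ Z) ≫ opM X.act (Y.X ⊗ A ⊗ Z) ≫ X.X ◁ opM Y.act Z
/-- The coaction on `X ⊗ Y` in right-bracketed form, next to a spectator object `Z`. -/
def tC (X Y : CrossedModule A) (Z : C) : X.X ⊗ Y.X ⊗ Z ⟶ X.X ⊗ Y.X ⊗ A ⊗ Z :=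
  X.X ◁ opD Y.coact Z ≫ opD X.coact (Y.X ⊗ A ⊗ Z) ≫ X.X ◁ opB A Y.X (A ⊗ Z) ≫ X.X ◁ Y.X ◁ opM μ Z
/-- The morphism `braid Y X` in right-bracketed form, next to a spectator object `Z`. -/
def br (Y X : CrossedModule A) (Z : C) : Y.X ⊗ X.X ⊗ Z ⟶ X.X ⊗ Y.X ⊗ Z :=
  Y.X ◁ opD X.coact Z ≫ opB Y.X X.X (A ⊗ Z) ≫ X.X ◁ opM Y.act Z

lemma opM_tensorAct (X Y : CrossedModule A) (Z : C) :
    opM (tensorAct X Y) Z = (α_ _ _ _).hom ≫ tA X Y Z ≫ (α_ _ _ _).inv := by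
  rw [tensorAct, tA, MonoidalCategory.tensorHom_def]; simp only [opD, opB, opM, tensorμ]; monoidal
lemma opD_tensorCoact (X Y : CrossedModule A) (Z : C) :
    opD (tensorCoact X Y) Z = (α_ _ _ _).hom ≫ tC X Y Z ≫ (α_ _ _ _).inv := by
  rw [tensorCoact, tC, MonoidalCategory.tensorHom_def']; simp only [opD, opB, opM, tensorμ]; monoidal
lemma braid_tail (Y X : CrossedModule A) (Z : C) :
    braid Y X ▷ Z = (α_ _ _ _).hom ≫ br Y X Z ≫ (α_ _ _ _).inv := by
  rw [braid, br]; simp only [opD, opB, opM]; monoidal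

lemma tA_tail (X Y : CrossedModule A) {Z Z' : C} (t : Z ⟶ Z') :
    tA X Y Z ≫ X.X ◁ Y.X ◁ t = X.X ◁ Y.X ◁ A ◁ t ≫ tA X Y Z' := by
  simp only [tA, Category.assoc]
  rw [wl22 _ (opM_tail _ _), as22 (opM_tail _ _) _, as22 (wl22 _ (opB_tail _)) _,
    as22 (wl22 _ (wl22 _ (opD_tail _ _))) _]

lemma tC_tail (X Y : CrossedModule A) {Z Z' : C} (t : Z ⟶ Z') :
    tC X Y Z ≫ X.X ◁ Y.X ◁ A ◁ t = X.X ◁ Y.X ◁ t ≫ tC X Y Z' := by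
  simp only [tC, Category.assoc]
  rw [wl22 _ (wl22 _ (opM_tail _ _)), as22 (wl22 _ (opB_tail _)) _, as22 (opD_tail _ _) _,
    as22 (wl22 _ (opD_tail _ _)) _]

/-- the braiding is a module map -/
lemma tA_br (Y X : CrossedModule A) (Z : C) :
    tA Y X Z ≫ br Y X Z = br Y X (A ⊗ Z) ≫ tA X Y Z := by
  simp only [tA, br, Category.assoc]
  rw [as22 (opM_tail Y.act (opM X.act Z)) _, as22 (opM_tail Y.act (opD X.coact Z)) _,
    as23 (opM_B Y.act) _, wl22 _ (Y.rn_mul Z), as22 (opB_tail (opM μ Z)) _]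
  have := congrArg (fun t => Y.X ◁ t) (X.rn_compat Z)
  simp only [whiskerLeft_comp] at this
  rw [reassoc_of% this]
  try simp only [whiskerLeft_comp, Category.assoc]
  rw [as22 ((opB_tail (opM μ Z)).symm) _, as23 (B_opM X.act) _,
    as22 (wl22 _ (opM_tail Y.act (opD Δ Z))) _, as22 (opB_tail (A ◁ opD Δ Z)) _,
    as22 (wl22 _ (opD_tail X.coact (opD Δ Z))) _, as23 (wl23 _ (opM_B Y.act)) _,
    as22 ((opM_tail X.act (opM Y.act _)).symm) _, wl22 _ (Y.rn_mul Z),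
    as22 (opB_tail (opB A A (A ⊗ Z))) _]

section bialg
variable (Z : C)
lemma _root_.Strand.mul_assoc' : opM μ[A] (A ⊗ Z) ≫ opM μ[A] Z = A ◁ opM μ[A] Z ≫ opM μ[A] Z :=
  (act_assoc_iff _ _).1 (MonObj.mul_assoc A) Z
lemma _root_.Strand.mul_one' : A ◁ opU η[A] Z ≫ opM μ[A] Z = 𝟙 _ :=
  (act_unit_iff _ _).1 (MonObj.mul_one A) Z
lemma _root_.Strand.one_mul' : opU η[A] (A ⊗ Z) ≫ opM μ[A] Z = 𝟙 _ := by
  have : opU η[A] (A ⊗ Z) ≫ opM μ[A] Z = (λ_ A).inv ▷ Z ≫ (η[A] ▷ A ≫ μ[A]) ▷ Z := by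
    simp only [opU, opM]; monoidal
  rw [this, MonObj.one_mul]; simp
lemma _root_.Strand.comul_assoc' : opD Δ[A] Z ≫ A ◁ opD Δ[A] Z = opD Δ[A] Z ≫ opD Δ[A] (A ⊗ Z) :=
  (coact_coassoc_iff _ _).1 (ComonObj.comul_assoc A) Z
lemma _root_.Strand.comul_counit' : opD Δ[A] Z ≫ A ◁ opE ε[A] Z = 𝟙 _ :=
  (coact_counit_iff _ _).1 (ComonObj.comul_counit A) Z
lemma _root_.Strand.counit_comul' : opD Δ[A] Z ≫ opE ε[A] (A ⊗ Z) = 𝟙 _ := by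
  have : opD Δ[A] Z ≫ opE ε[A] (A ⊗ Z) = (Δ[A] ≫ ε[A] ▷ A) ▷ Z ≫ (λ_ A).hom ▷ Z := by
    simp only [opE, opD]; monoidal
  rw [this, ComonObj.counit_comul]; simp
lemma _root_.Strand.one_comul' : opU η[A] Z ≫ opD Δ[A] Z = opU η[A] Z ≫ opU η[A] (A ⊗ Z) := by
  have : opU η[A] Z ≫ opD Δ[A] Z = (λ_ Z).inv ≫ (η[A] ≫ Δ[A]) ▷ Z ≫ (α_ A A Z).hom := by
    simp only [opU, opD, comp_whiskerRight, Category.assoc]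
  rw [this, BimonObj.one_comul]
  simp only [opU, tensorObj.one_def, MonoidalCategory.tensorHom_def']
  monoidal
end bialg

lemma tA_mul (X Y : CrossedModule A) (Z : C) :
    tA X Y (A ⊗ Z) ≫ tA X Y Z = X.X ◁ Y.X ◁ opM μ Z ≫ tA X Y Z := by
  simp only [tA, Category.assoc]
  rw [as22 (wl22 _ (opM_tail _ _)) _, as23 (wl23 _ (opM_B _)) _, as22 ((opM_tail _ _).symm) _,
    wl22 _ (Y.rn_mul _), as22 (opM_tail _ _) _, as22 (opM_tail _ _) _, as22 (opM_tail _ _) _,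
    as22 (wl22 _ (opB_tail _)) _, as22 (wl22 _ (opB_tail _)) _,
    as22 (wl22 _ (wl22 _ (opD_tail _ _))) _]
  rw [as25 (wl25 _ (wl25 _ (bialg _))) _, as22 (wl22 _ ((opB_tail (opM μ Z)).symm)) _,
    as23 (wl23 _ (B_opM _)) _, as22 ((opM_tail X.act (Y.X ◁ opM μ Z)).symm) _,
    as22 ((X.rn_mul _).symm) _]

lemma tA_one (X Y : CrossedModule A) (Z : C) :
    X.X ◁ Y.X ◁ opU η Z ≫ tA X Y Z = 𝟙 _ := by
  simp only [tA, Category.assoc]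
  rw [as22 (wl22 _ (wl22 _ (one_comul' _))) _, as21 (wl21 _ (B_opU _)) _, as21 (X.rn_one _) _]
  rw [Category.id_comp, wl21 _ (Y.rn_one _)]; simp

lemma tensor_compat (X Y : CrossedModule A) (Z : C) :
    X.X ◁ Y.X ◁ opD Δ Z ≫ X.X ◁ opB Y.X A (A ⊗ Z) ≫ opB X.X A (Y.X ⊗ A ⊗ Z) ≫
      A ◁ tA X Y Z ≫ A ◁ tC X Y Z ≫ opB A X.X (Y.X ⊗ A ⊗ Z) ≫ X.X ◁ opB A Y.X (A ⊗ Z) ≫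
      X.X ◁ Y.X ◁ opM μ Z =
    X.X ◁ Y.X ◁ opD Δ Z ≫ tC X Y (A ⊗ A ⊗ Z) ≫ X.X ◁ Y.X ◁ opB A A (A ⊗ Z) ≫
      tA X Y (A ⊗ A ⊗ Z) ≫ X.X ◁ Y.X ◁ opM μ Z := by
  simp only [tA, tC, whiskerLeft_comp, Category.assoc]
  rw [as22 ((opB_tail _).symm) _, as22 (opB_tail _) _, as22 ((opB_tail (opB A Y.X (A ⊗ Z))).symm) _,
    as22 (opB_tail (opB Y.X A (A ⊗ Z))) _, as22 (wl22 _ (opB_tail _)) _,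
    as22 (wl22 _ (wl22 _ (comul_assoc' _))) _, as32 (wl32 _ (B_opD _)) _,
    as22 (wl22 _ ((opB_tail _).symm)) _, wl22 _ (wl22 _ ((mul_assoc' _).symm)),
    as32 (wl32 _ ((opM_B μ[A]).symm)) _, as22 (wl22 _ ((opD_tail _ (opD Y.coact _)).symm)) _,
    as22 (wl22 _ ((opD_tail _ (opM Y.act _)).symm)) _, as22 ((opB_tail (A ◁ opD Y.coact _)).symm) _,
    as22 ((opB_tail (A ◁ opM Y.act _)).symm) _,
    as22 (wl22 _ ((opM_tail μ[A] (opD Y.coact _)).symm)) _,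
    as22 (wl22 _ ((opM_tail μ[A] (opM Y.act _)).symm)) _]
  have hX := X.rn_compat (Y.X ⊗ A ⊗ Z)
  rw [reassoc_of% (congrArg (fun t => t) hX)]
  try simp only [whiskerLeft_comp, Category.assoc]
  rw [as22 (wl22 _ (opM_tail _ (opM Y.act _))) _, as22 (wl22 _ (opM_tail _ (opD Y.coact _))) _,
    as23 (wl23 _ (opM_B _)) _, wl22 _ (wl22 _ (mul_assoc' _)), as22 (wl22 _ (opB_tail (opM μ Z))) _,
    as23 (wl23 _ ((B_opD _).symm)) _, as22 (wl22 _ (wl22 _ ((comul_assoc' _).symm))) _,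
    as22 (wl22 _ ((opB_tail _).symm)) _, as22 ((opD_tail _ (A ◁ opB Y.X A _)).symm) _,
    as22 (wl22 _ ((opB_tail (opB Y.X A _)).symm)) _, as22 ((opM_tail _ (A ◁ opB Y.X A _)).symm) _,
    as22 ((opD_tail _ (A ◁ Y.X ◁ opD Δ _)).symm) _,
    as22 (wl22 _ ((opB_tail (Y.X ◁ opD Δ _)).symm)) _,
    as22 ((opM_tail _ (A ◁ Y.X ◁ opD Δ _)).symm) _]
  have hY := congrArg (fun t => X.X ◁ A ◁ t) (Y.rn_compat Z)
  simp only [whiskerLeft_comp] at hY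
  rw [reassoc_of% hY]
  try simp only [whiskerLeft_comp, Category.assoc]
  rw [as22 (wl22 _ ((opB_tail (opM μ Z)).symm)) _, as23 (wl23 _ (B_opM _)) _,
    as22 (wl22 _ ((opB_tail (opB A A _)).symm)) _, as23 (wl23 _ (wl23 _ (opM_B _))) _,
    as22 (wl22 _ (wl22 _ ((opD_tail Δ[A] (opM μ[A] (A ⊗ Z))).symm))) _,
    as22 (wl22 _ ((opB_tail (A ◁ opM μ (A ⊗ Z))).symm)) _,
    as22 ((opM_tail X.act (Y.X ◁ A ◁ opM μ (A ⊗ Z))).symm) _,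
    as22 (wl22 _ ((opM_tail Y.act (opM μ (A ⊗ Z))).symm)) _, wl22 _ (wl22 _ (mul_assoc' _)),
    as23 (wl23 _ (wl23 _ ((B_opD _).symm))) _, as23 (wl23 _ (wl23 _ (wl23 _ ((B_opD _).symm)))) _,
    as22 (wl22 _ (opB_tail (A ◁ opD Δ (A ⊗ Z)))) _,
    as22 (opD_tail X.coact (Y.X ◁ A ◁ opD Δ (A ⊗ Z))) _,
    as22 (wl22 _ (opD_tail Y.coact (opD Δ (A ⊗ Z)))) _, as22 (opM_tail X.act (A ◁ Y.X ◁ opD Δ Z)) _,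
    as22 (opM_tail X.act (A ◁ opD Y.coact _)) _, as22 (opM_tail X.act (opB A Y.X _)) _,
    as22 (opM_tail X.act (Y.X ◁ A ◁ opB A A _)) _, as22 (opM_tail X.act (Y.X ◁ opB A A _)) _,
    as22 (wl22 _ (opB_tail (Y.X ◁ opD Δ Z))) _, as22 (opD_tail X.coact (A ◁ Y.X ◁ opD Δ Z)) _,
    as22 (wl22 _ (opB_tail (opD Δ Z))) _, as22 (wl22 _ (wl22 _ (comul_assoc' _))) _,
    as22 (wl22 _ (opB_tail (opD Y.coact _))) _, as22 (opD_tail X.coact (A ◁ opD Y.coact _)) _,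
    as23 (wl23 _ ((opD_B _).symm)) _, as22 ((opD_tail X.coact (opB Y.X A _)).symm) _,
    as22 ((opD_tail X.coact (Y.X ◁ opB A A _)).symm) _, as33 (wl33 _ (opB_B.symm)) _,
    as22 (wl22 _ ((opB_tail (X := A) (opB A A (A ⊗ A ⊗ Z))).symm)) _,
    as22 (wl22 _ (opB_tail (A ◁ opB A A _))) _,
    as22 (wl22 _ (opB_tail (X := Y.X) (opB A A (A ⊗ A ⊗ Z)))) _,
    as22 (wl22 _ (wl22 _ (opB_tail (opB A A _)))) _]

section
variable (Z : C)
lemma _root_.Strand.mul_counit' : opM μ[A] Z ≫ opE ε[A] Z = A ◁ opE ε[A] Z ≫ opE ε[A] Z := by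
  have : opM μ[A] Z ≫ opE ε[A] Z = (α_ A A Z).inv ≫ (μ[A] ≫ ε[A]) ▷ Z ≫ (λ_ Z).hom := by
    simp only [opM, opE, comp_whiskerRight, Category.assoc]
  rw [this, BimonObj.mul_counit]
  simp only [opE, Comon.tensorObj_counit, MonoidalCategory.tensorHom_def']
  monoidal
end

lemma tC_comul (X Y : CrossedModule A) (Z : C) :
    tC X Y Z ≫ tC X Y (A ⊗ Z) = tC X Y Z ≫ X.X ◁ Y.X ◁ opD Δ Z := by
  simp only [tC, Category.assoc]
  rw [as22 (wl22 _ ((opD_tail _ (opM μ Z)).symm)) _, as23 (wl23 _ ((B_opD _).symm)) _,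
    as22 (opD_tail X.coact (opD Y.coact _)) _, as22 (wl22 _ ((Y.rn_comul _).symm)) _,
    as22 ((opD_tail X.coact (Y.X ◁ A ◁ opM μ Z)).symm) _,
    as22 ((opD_tail X.coact (Y.X ◁ opB A A (A ⊗ Z))).symm) _,
    as22 ((opD_tail X.coact (opB A Y.X (A ⊗ A ⊗ Z))).symm) _,
    as22 (wl22 _ ((opB_tail (A ◁ opM μ Z)).symm)) _,
    as22 (wl22 _ ((opB_tail (opB A A (A ⊗ Z))).symm)) _,
    wl22 _ (wl22 _ ((opM_tail μ[A] (opM μ Z)).symm)), wl25 _ (wl25 _ (bialg _)),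
    as22 (wl22 _ (opB_tail (opD Δ Z))) _, as23 (wl23 _ ((opD_B _).symm)) _,
    as22 (opD_tail X.coact (Y.X ◁ opD Δ Z)) _, as22 ((X.rn_comul _).symm) _]

lemma tC_counit (X Y : CrossedModule A) (Z : C) :
    tC X Y Z ≫ X.X ◁ Y.X ◁ opE ε Z = 𝟙 _ := by
  simp only [tC, Category.assoc]
  rw [wl22 _ (wl22 _ (mul_counit' _)), as22 (wl22 _ (opB_tail (opE ε Z))) _, wl21 _ (B_opE _),
    as22 (opD_tail X.coact (Y.X ◁ opE ε Z)) _, X.rn_counit _]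
  rw [Category.comp_id, wl21 _ (Y.rn_counit _)]; simp

/-- the braiding is a comodule map -/
lemma br_tC (X Y : CrossedModule A) (Z : C) :
    br X Y Z ≫ tC Y X Z = tC X Y Z ≫ br X Y (A ⊗ Z) := by
  simp only [tC, br, Category.assoc]
  rw [as22 ((opD_tail Y.coact (opD X.coact Z)).symm) _,
    as22 ((opD_tail Y.coact (opM X.act Z)).symm) _, as23 ((B_opD _).symm) _,
    as22 (wl22 _ ((Y.rn_comul _).symm)) _, as22 ((opB_tail (opD Δ Z)).symm) _]
  have := congrArg (fun t => Y.X ◁ t) (X.rn_compat Z)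
  simp only [whiskerLeft_comp] at this
  simp only [reassoc_of% this, this]
  rw [as22 (opB_tail (opD Δ Z)) _, as23 ((opD_B _).symm) _,
    as22 (wl22 _ ((opD_tail _ (opM μ Z)).symm)) _, as22 ((opB_tail (A ◁ opM μ Z)).symm) _,
    wl22 _ ((opM_tail X.act (opM μ Z)).symm), as23 (wl23 _ ((B_opD _).symm)) _,
    as22 (opD_tail X.coact (opD Y.coact _)) _, as22 (wl22 _ ((Y.rn_comul _).symm)) _,
    as22 ((opB_tail (opB A A _)).symm) _]

lemma br_hex₁ (X Y W : CrossedModule A) (Z : C) :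
    X.X ◁ tC Y W Z ≫ opB X.X Y.X (W.X ⊗ A ⊗ Z) ≫ Y.X ◁ opB X.X W.X (A ⊗ Z) ≫
      Y.X ◁ W.X ◁ opM X.act Z = br X Y (W.X ⊗ Z) ≫ Y.X ◁ br X W Z := by
  simp only [tC, br, whiskerLeft_comp, Category.assoc]
  rw [as22 ((opB_tail (W.X ◁ opM μ Z)).symm) _, as22 (wl22 _ ((opB_tail (opM μ Z)).symm)) _,
    wl22 _ (wl22 _ ((X.rn_mul _).symm)), as22 ((opB_tail _).symm) _,
    as32 (wl32 _ ((opM_B X.act).symm)) _, as22 (wl22 _ (opM_tail _ (opD W.coact _))) _,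
    as22 (opB_tail (A ◁ opD W.coact _)) _, as22 (wl22 _ (opD_tail Y.coact _)) _]

lemma br_hex₂ (X Y W : CrossedModule A) (Z : C) :
    X.X ◁ Y.X ◁ opD W.coact Z ≫ X.X ◁ opB Y.X W.X (A ⊗ Z) ≫ opB X.X W.X (Y.X ⊗ A ⊗ Z) ≫
      W.X ◁ tA X Y Z = X.X ◁ br Y W Z ≫ br X W (Y.X ⊗ Z) := by
  simp only [tA, br, whiskerLeft_comp, Category.assoc]
  rw [as22 (opB_tail (Y.X ◁ opD Δ Z)) _, as22 (wl22 _ (opB_tail (opD Δ Z))) _,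
    as22 (wl22 _ (wl22 _ (W.rn_comul _))) _, as22 (opB_tail (opB Y.X A (A ⊗ Z))) _,
    as32 (wl32 _ (B_opD W.coact)) _, as22 (wl22 _ ((opD_tail W.coact (opM Y.act _)).symm)) _,
    as22 ((opB_tail (A ◁ opM Y.act _)).symm) _, wl22 _ ((opM_tail X.act _).symm)]

lemma tA_assoc (X Y W : CrossedModule A) (Z : C) :
    X.X ◁ Y.X ◁ W.X ◁ opD Δ Z ≫ X.X ◁ Y.X ◁ opB W.X A (A ⊗ Z) ≫ tA X Y (W.X ⊗ A ⊗ Z) ≫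
      X.X ◁ Y.X ◁ opM W.act Z =
    X.X ◁ Y.X ◁ W.X ◁ opD Δ Z ≫ X.X ◁ Y.X ◁ opB W.X A (A ⊗ Z) ≫
      X.X ◁ opB Y.X A (W.X ⊗ A ⊗ Z) ≫ opM X.act (Y.X ⊗ W.X ⊗ A ⊗ Z) ≫ X.X ◁ tA Y W Z := by
  simp only [tA, whiskerLeft_comp, Category.assoc]
  rw [as22 (opM_tail X.act (Y.X ◁ W.X ◁ opD Δ Z)) _, as22 (wl22 _ (opB_tail (W.X ◁ opD Δ Z))) _,
    as22 (wl22 _ (wl22 _ (opB_tail (opD Δ Z)))) _,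
    as22 (wl22 _ (wl22 _ (wl22 _ (comul_assoc' _)))) _, as22 (opM_tail X.act (Y.X ◁ opB W.X A _)) _,
    as22 (wl22 _ (opB_tail (opB W.X A (A ⊗ Z)))) _, as32 (wl32 _ (wl32 _ (B_opD Δ[A]))) _]

lemma tC_assoc (X Y W : CrossedModule A) (Z : C) :
    X.X ◁ Y.X ◁ opD W.coact Z ≫ tC X Y (W.X ⊗ A ⊗ Z) ≫ X.X ◁ Y.X ◁ opB A W.X (A ⊗ Z) ≫
      X.X ◁ Y.X ◁ W.X ◁ opM μ Z =
    X.X ◁ tC Y W Z ≫ opD X.coact (Y.X ⊗ W.X ⊗ A ⊗ Z) ≫ X.X ◁ opB A Y.X (W.X ⊗ A ⊗ Z) ≫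
      X.X ◁ Y.X ◁ opB A W.X (A ⊗ Z) ≫ X.X ◁ Y.X ◁ W.X ◁ opM μ Z := by
  simp only [tC, whiskerLeft_comp, Category.assoc]
  rw [as22 ((opD_tail X.coact (Y.X ◁ W.X ◁ opM μ Z)).symm) _,
    as22 (wl22 _ ((opB_tail (W.X ◁ opM μ Z)).symm)) _,
    as22 (wl22 _ (wl22 _ ((opB_tail (opM μ Z)).symm))) _,
    wl22 _ (wl22 _ (wl22 _ ((mul_assoc' _).symm))),
    as22 ((opD_tail X.coact (Y.X ◁ opB A W.X _)).symm) _,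
    as22 (wl22 _ ((opB_tail (opB A W.X (A ⊗ Z))).symm)) _,
    as32 (wl32 _ (wl32 _ ((opM_B μ[A]).symm))) _]
end CrossedModule

namespace Strand
variable {C : Type u} [Category.{v} C] [MonoidalCategory C] [BraidedCategory C]
variable {X Y W V Z : C}

lemma Bi_opS (f : X ⟶ W) : V ◁ f ▷ Z ≫ opBi V W Z = opBi V X Z ≫ f ▷ (V ⊗ Z) :=
  letI := reverseBraiding C; B_opS (C := C) f
lemma Bi_opM (f : X ⊗ Y ⟶ W) :
    V ◁ opM f Z ≫ opBi V W Z = opBi V X (Y ⊗ Z) ≫ X ◁ opBi V Y Z ≫ opM f (V ⊗ Z) :=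
  @B_opM C _ _ (reverseBraiding C) X Y W V Z f
lemma opD_Bi (f : W ⟶ X ⊗ Y) :
    opD f (V ⊗ Z) ≫ X ◁ opBi Y V Z ≫ opBi X V (Y ⊗ Z) = opBi W V Z ≫ V ◁ opD f Z :=
  @opD_B C _ _ (reverseBraiding C) X Y W V Z f
lemma Bi_opU (f : 𝟙_ C ⟶ X) : V ◁ opU f Z ≫ opBi V X Z = opU f (V ⊗ Z) :=
  @B_opU C _ _ (reverseBraiding C) X V Z f
lemma Bi_opE (f : X ⟶ 𝟙_ C) : opBi X V Z ≫ V ◁ opE f Z = opE f (V ⊗ Z) :=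
  @B_opE C _ _ (reverseBraiding C) X V Z f

variable {A : C} [HopfObj A]

lemma opS_left (Z : C) : opD Δ[A] Z ≫ 𝒮[A] ▷ (A ⊗ Z) ≫ opM μ[A] Z = opE ε Z ≫ opU η Z := by
  have : opD Δ[A] Z ≫ 𝒮[A] ▷ (A ⊗ Z) ≫ opM μ[A] Z = (Δ[A] ≫ 𝒮[A] ▷ A ≫ μ[A]) ▷ Z := by
    simp only [opD, opM]; monoidal
  rw [this, HopfObj.antipode_left]; simp [opE, opU]
lemma opS_right (Z : C) : opD Δ[A] Z ≫ A ◁ 𝒮[A] ▷ Z ≫ opM μ[A] Z = opE ε Z ≫ opU η Z := by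
  have : opD Δ[A] Z ≫ A ◁ 𝒮[A] ▷ Z ≫ opM μ[A] Z = (Δ[A] ≫ A ◁ 𝒮[A] ≫ μ[A]) ▷ Z := by
    simp only [opD, opM]; monoidal
  rw [this, HopfObj.antipode_right]; simp [opE, opU]
lemma opU_S (Z : C) : opU η[A] Z ≫ 𝒮[A] ▷ Z = opU η Z := by
  simp only [opU, Category.assoc, ← comp_whiskerRight, HopfObj.one_antipode]
lemma S_opE (Z : C) : 𝒮[A] ▷ Z ≫ opE ε[A] Z = opE ε Z := by
  simp only [opE, ← comp_whiskerRight_assoc, HopfObj.antipode_counit]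
lemma opM_S (Z : C) : opM μ[A] Z ≫ 𝒮[A] ▷ Z =
    𝒮[A] ▷ (A ⊗ Z) ≫ A ◁ 𝒮[A] ▷ Z ≫ opB A A Z ≫ opM μ Z := by
  have : opM μ[A] Z ≫ 𝒮[A] ▷ Z = (α_ A A Z).inv ≫ (μ[A] ≫ 𝒮[A]) ▷ Z := by
    simp only [opM, comp_whiskerRight, Category.assoc]
  rw [this, HopfObj.mul_antipode, MonoidalCategory.tensorHom_def]
  simp only [opM, opB]; monoidal
lemma S_opD (Z : C) : 𝒮[A] ▷ Z ≫ opD Δ[A] Z =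
    opD Δ[A] Z ≫ opB A A Z ≫ 𝒮[A] ▷ (A ⊗ Z) ≫ A ◁ 𝒮[A] ▷ Z := by
  have : 𝒮[A] ▷ Z ≫ opD Δ[A] Z = (𝒮[A] ≫ Δ[A]) ▷ Z ≫ (α_ A A Z).hom := by
    simp only [opD, comp_whiskerRight, Category.assoc]
  rw [this, HopfObj.antipode_comul, MonoidalCategory.tensorHom_def]
  simp only [opD, opB]; monoidal

variable [IsIso 𝒮[A]]

lemma opSi_right (Z : C) :
    opD Δ[A] Z ≫ opBi A A Z ≫ A ◁ inv 𝒮[A] ▷ Z ≫ opM μ[A] Z = opE ε Z ≫ opU η Z := by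
  have h : Δ[A] ≫ (β_ A A).inv ≫ A ◁ inv 𝒮[A] ≫ μ[A] = ε[A] ≫ η[A] := by
    rw [← cancel_epi 𝒮[A], ← Category.assoc, HopfObj.antipode_comul, HopfObj.antipode_counit_assoc,
      Category.assoc, Category.assoc, ← BraidedCategory.braiding_naturality_assoc,
      Iso.hom_inv_id_assoc, MonoidalCategory.tensorHom_def, Category.assoc,
      ← whiskerLeft_comp_assoc, IsIso.hom_inv_id, whiskerLeft_id, Category.id_comp,
      HopfObj.antipode_left]
  have : opD Δ[A] Z ≫ opBi A A Z ≫ A ◁ inv 𝒮[A] ▷ Z ≫ opM μ[A] Z =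
      (Δ[A] ≫ (β_ A A).inv ≫ A ◁ inv 𝒮[A] ≫ μ[A]) ▷ Z := by
    simp only [opD, opM, opBi]; monoidal
  rw [this, h]; simp [opE, opU]

lemma opSi_left (Z : C) :
    opD Δ[A] Z ≫ A ◁ inv 𝒮[A] ▷ Z ≫ opBi A A Z ≫ opM μ[A] Z = opE ε Z ≫ opU η Z := by
  have h : Δ[A] ≫ A ◁ inv 𝒮[A] ≫ (β_ A A).inv ≫ μ[A] = ε[A] ≫ η[A] := by
    rw [← cancel_epi 𝒮[A], ← Category.assoc, HopfObj.antipode_comul, HopfObj.antipode_counit_assoc,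
      Category.assoc, Category.assoc, MonoidalCategory.tensorHom_def, Category.assoc,
      ← whiskerLeft_comp_assoc, IsIso.hom_inv_id, whiskerLeft_id, Category.id_comp,
      ← BraidedCategory.braiding_naturality_right_assoc,
      Iso.hom_inv_id_assoc, HopfObj.antipode_right]
  have : opD Δ[A] Z ≫ A ◁ inv 𝒮[A] ▷ Z ≫ opBi A A Z ≫ opM μ[A] Z =
      (Δ[A] ≫ A ◁ inv 𝒮[A] ≫ (β_ A A).inv ≫ μ[A]) ▷ Z := by
    simp only [opD, opM, opBi]; monoidal
  rw [this, h]; simp [opE, opU]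

end Strand

namespace CrossedModule
open Strand
section
variable {C : Type u} [Category.{v} C] [MonoidalCategory C] [BraidedCategory C]
variable {A : C} [HopfObj A] [IsIso 𝒮[A]]

/-- The inverse of `braid Y X`. -/
noncomputable def braidInv (Y X : CrossedModule A) : X.X ⊗ Y.X ⟶ Y.X ⊗ X.X :=
  X.coact ▷ Y.X ≫ (α_ X.X A Y.X).hom ≫ X.X ◁ (β_ Y.X A).inv ≫ (α_ X.X Y.X A).inv ≫
    (β_ Y.X X.X).inv ▷ A ≫ (α_ Y.X X.X A).hom ≫ Y.X ◁ X.X ◁ inv 𝒮[A] ≫ Y.X ◁ (β_ A X.X).inv ≫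
    (α_ Y.X A X.X).inv ≫ Y.act ▷ X.X

/-- The morphism `braidInv Y X` in right-bracketed form, next to a spectator object `Z`. -/
noncomputable def bri (Y X : CrossedModule A) (Z : C) : X.X ⊗ Y.X ⊗ Z ⟶ Y.X ⊗ X.X ⊗ Z :=
  opD X.coact (Y.X ⊗ Z) ≫ X.X ◁ opBi A Y.X Z ≫ opBi X.X Y.X (A ⊗ Z) ≫
    Y.X ◁ X.X ◁ inv 𝒮[A] ▷ Z ≫ Y.X ◁ opBi X.X A Z ≫ opM Y.act (X.X ⊗ Z)

lemma braidInv_tail (Y X : CrossedModule A) (Z : C) :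
    braidInv Y X ▷ Z = (α_ _ _ _).hom ≫ bri Y X Z ≫ (α_ _ _ _).inv := by
  rw [braidInv, bri]; simp only [opD, opBi, opM]; monoidal

lemma br_bri (Y X : CrossedModule A) (Z : C) : br Y X Z ≫ bri Y X Z = 𝟙 _ := by
  simp only [br, bri, Category.assoc]
  rw [as22 ((opD_tail X.coact (opM Y.act _)).symm) _, as23 (wl23 _ (Bi_opM Y.act)) _,
    as23 (Bi_opM Y.act) _, as22 (opM_tail Y.act (X.X ◁ inv 𝒮[A] ▷ Z)) _,
    as22 (opM_tail Y.act (opBi X.X A Z)) _, Y.rn_mul _, as23 ((B_opD X.coact).symm) _,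
    as21 (wl21 _ (B_Bi)) _]
  simp only [whiskerLeft_id, Category.id_comp]
  rw [as22 (wl22 _ ((X.rn_comul _).symm)) _, as22 (opB_tail (opBi A A _)) _, as21 (B_Bi) _]
  simp only [Category.id_comp]
  rw [as22 (wl22 _ (opBi_tail (inv 𝒮[A] ▷ Z))) _, as32 (wl32 _ ((Bi_opM μ[A]).symm)) _]
  have := congrArg (fun t => Y.X ◁ X.X ◁ t) (opSi_right (A := A) Z)
  simp only [whiskerLeft_comp] at this
  rw [reassoc_of% this]
  try simp only [whiskerLeft_comp, Category.assoc]
  rw [as21 (wl21 _ (Bi_opU _)) _, Y.rn_one _, as21 (wl21 _ (X.rn_counit _)) _]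
  simp

lemma bri_br (Y X : CrossedModule A) (Z : C) : bri Y X Z ≫ br Y X Z = 𝟙 _ := by
  simp only [br, bri, Category.assoc]
  rw [as22 (opM_tail Y.act (opD X.coact _)) _, as23 (wl23 _ ((opD_Bi X.coact).symm)) _,
    as22 (wl22 _ ((opD_tail X.coact (inv 𝒮[A] ▷ _)).symm)) _, as23 ((opD_Bi X.coact).symm) _,
    as22 ((opD_tail X.coact (opBi A Y.X _)).symm) _, as22 ((X.rn_comul _).symm) _,
    as23 (opM_B Y.act) _, wl22 _ (Y.rn_mul _), as21 (wl21 _ (Bi_B)) _]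
  simp only [whiskerLeft_id, Category.id_comp]
  rw [as22 (opB_tail (opM μ _)) _, as22 (opBi_tail (A ◁ inv 𝒮[A] ▷ Z)) _,
    as22 (opBi_tail (opBi A A _)) _, as22 (opBi_tail (opM μ _)) _, as21 (Bi_B) _]
  simp only [Category.id_comp]
  rw [as32 (wl32 _ (opD_Bi Δ[A])) _]
  have := congrArg (fun t => X.X ◁ Y.X ◁ t) (opSi_left (A := A) Z)
  simp only [whiskerLeft_comp] at this
  rw [reassoc_of% this]
  try simp only [whiskerLeft_comp, Category.assoc]
  rw [as21 (wl21 _ (Bi_opE _)) _, wl21 _ (Y.rn_one _)]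
  rw [whiskerLeft_id, Category.comp_id]
  try simp only [whiskerLeft_comp, Category.assoc]
  rw [X.rn_counit _]

end

section
variable {C : Type u} [Category.{v} C] [MonoidalCategory C] [BraidedCategory C]
variable {A : C} [BimonObj A]

/-- Morphisms of right crossed modules: morphisms of the underlying category that are both
`A`-module and `A`-comodule morphisms. -/
@[ext] structure Hom (X Y : CrossedModule A) where
  hom : X.X ⟶ Y.X
  act_hom : X.act ≫ hom = hom ▷ A ≫ Y.act
  coact_hom : hom ≫ Y.coact = X.coact ≫ hom ▷ A

attribute [simp] Hom.act_hom Hom.coact_hom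

instance : Category (CrossedModule A) where
  Hom X Y := Hom X Y
  id X := ⟨𝟙 _, by simp, by simp⟩
  comp f g := ⟨f.hom ≫ g.hom, by rw [← Category.assoc, f.act_hom]; simp,
    by rw [Category.assoc, g.coact_hom, ← Category.assoc, f.coact_hom]; simp⟩
  id_comp f := by apply Hom.ext; simp
  comp_id f := by apply Hom.ext; simp
  assoc f g h := by apply Hom.ext; simp

lemma hom_ext' {X Y : CrossedModule A} {f g : X ⟶ Y} (h : f.hom = g.hom) : f = g := Hom.ext h
@[simp] lemma id_hom (X : CrossedModule A) : (𝟙 X : X ⟶ X).hom = 𝟙 X.X := rfl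
@[simp] lemma comp_hom {X Y W : CrossedModule A} (f : X ⟶ Y) (g : Y ⟶ W) :
    (f ≫ g).hom = f.hom ≫ g.hom := rfl

/-- An isomorphism of underlying objects that respects both structures. -/
def mkIso {X Y : CrossedModule A} (e : X.X ≅ Y.X) (h₁ : X.act ≫ e.hom = e.hom ▷ A ≫ Y.act)
    (h₂ : e.hom ≫ Y.coact = X.coact ≫ e.hom ▷ A) : X ≅ Y where
  hom := ⟨e.hom, h₁, h₂⟩
  inv := ⟨e.inv, by
    rw [← cancel_mono e.hom, Category.assoc, Category.assoc, h₁, ← comp_whiskerRight_assoc]; simp,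
    by rw [← cancel_epi e.hom, reassoc_of% h₂, ← comp_whiskerRight]; simp⟩
  hom_inv_id := by apply Hom.ext; simp
  inv_hom_id := by apply Hom.ext; simp

@[simp] lemma mkIso_hom_hom {X Y : CrossedModule A} (e : X.X ≅ Y.X) (h₁ h₂) :
    (mkIso (X := X) (Y := Y) e h₁ h₂).hom.hom = e.hom := rfl
@[simp] lemma mkIso_inv_hom {X Y : CrossedModule A} (e : X.X ≅ Y.X) (h₁ h₂) :
    (mkIso (X := X) (Y := Y) e h₁ h₂).inv.hom = e.inv := rfl

/-- The tensor product of right crossed modules. -/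
abbrev tensorObj (X Y : CrossedModule A) : CrossedModule A where
  X := X.X ⊗ Y.X
  act := tensorAct X Y
  coact := tensorCoact X Y
  act_one := by
    rw [act_unit_iff]; intro Z
    rw [opM_tensorAct, associator_naturality_right_assoc, reassoc_of% tA_one]; simp
  act_mul := by
    rw [act_assoc_iff]; intro Z
    simp only [opM_tensorAct, Category.assoc, Iso.inv_hom_id_assoc]
    rw [associator_naturality_right_assoc, reassoc_of% tA_mul]
  coact_counit := by
    rw [coact_counit_iff]; intro Z
    rw [opD_tensorCoact, Category.assoc, Category.assoc, ← associator_inv_naturality_right,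
      reassoc_of% tC_counit]; simp
  coact_comul := by
    rw [coact_coassoc_iff]; intro Z
    simp only [opD_tensorCoact, Category.assoc, Iso.inv_hom_id_assoc]
    rw [← associator_inv_naturality_right, reassoc_of% tC_comul]
  compatibility := by
    rw [compat_iff]; intro Z
    simp only [opD_tensorCoact, opM_tensorAct, opB_tensor_left, opB_tensor_right,
      whiskerLeft_comp, Category.assoc, Iso.inv_hom_id_assoc]
    rw [associator_naturality_right_assoc]
    simp only [whiskerLeft_inv_hom_assoc, ← associator_inv_naturality_right,
      associator_naturality_right_assoc, Iso.inv_hom_id_assoc]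
    rw [reassoc_of% (tensor_compat X Y Z)]

/-- The tensor product of morphisms of right crossed modules. -/
def tensorHom {X Y X' Y' : CrossedModule A} (f : X ⟶ X') (g : Y ⟶ Y') :
    tensorObj X Y ⟶ tensorObj X' Y' where
  hom := f.hom ⊗ₘ g.hom
  act_hom := by
    simp only [tensorObj, tensorAct, Category.assoc, tensorHom_comp_tensorHom, Hom.act_hom]
    rw [← tensorHom_comp_tensorHom, ← tensorμ_natural_left_assoc, whisker_exchange_assoc]
  coact_hom := by
    simp only [tensorObj, tensorCoact, Category.assoc, tensorHom_comp_tensorHom_assoc,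
      Hom.coact_hom]
    rw [← tensorHom_comp_tensorHom_assoc, ← tensorHom_id, ← tensorHom_id, tensorμ_natural_assoc]
    simp only [id_whiskerRight, tensorHom_id, whisker_exchange]

/-- The unit object with the trivial action and coaction. -/
abbrev tensorUnit : CrossedModule A where
  X := 𝟙_ C
  act := (λ_ A).hom ≫ ε
  coact := η ≫ (λ_ A).inv
  act_one := by simp [unitors_equal]
  act_mul := by
    rw [leftUnitor_naturality_assoc, BimonObj.mul_counit]
    simp only [Comon.tensorObj_counit, MonoidalCategory.tensorHom_def]
    monoidal
  coact_counit := by simp [unitors_inv_equal]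
  coact_comul := by
    rw [Category.assoc, ← leftUnitor_inv_naturality, reassoc_of% BimonObj.one_comul]
    simp only [tensorObj.one_def, MonoidalCategory.tensorHom_def']
    monoidal
  compatibility := by
    rw [compat_iff]; intro Z
    have h1 : ∀ Z, opM ((λ_ A).hom ≫ ε) Z = (λ_ _).hom ≫ opE ε[A] Z ≫ (λ_ _).inv := fun Z => by
      simp only [opM, opE]; monoidal
    have h2 : ∀ Z, opD (η ≫ (λ_ A).inv) Z = (λ_ _).hom ≫ opU η[A] Z ≫ (λ_ _).inv := fun Z => by
      simp only [opD, opU]; monoidal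
    have e1 : ∀ {P Q : C} (t : P ⟶ Q), 𝟙_ C ◁ t = (λ_ P).hom ≫ t ≫ (λ_ Q).inv := by simp
    simp only [h1, h2, opB_unit_left, opB_unit_right, e1, whiskerLeft_comp, Category.assoc,
      Iso.inv_hom_id_assoc, whiskerLeft_inv_hom_assoc]
    rw [reassoc_of% comul_counit', reassoc_of% opE_B, reassoc_of% opU_tail,
      reassoc_of% mul_one', reassoc_of% counit_comul', reassoc_of% one_mul']

/-- The associator of right crossed modules. -/
def associator (X Y W : CrossedModule A) :
    tensorObj (tensorObj X Y) W ≅ tensorObj X (tensorObj Y W) :=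
  mkIso (α_ X.X Y.X W.X) (by
    refine (actHom_iff _ _ _).2 fun Z => ?_
    have e1 : opM (tensorAct (tensorObj X Y) W) Z ≫ (α_ X.X Y.X W.X).hom ▷ Z =
      ((α_ (X.X ⊗ Y.X) W.X (A ⊗ Z)).hom ≫ (α_ X.X Y.X (W.X ⊗ A ⊗ Z)).hom) ≫
      (X.X ◁ Y.X ◁ W.X ◁ opD Δ Z ≫ X.X ◁ Y.X ◁ opB W.X A (A ⊗ Z) ≫ tA X Y (W.X ⊗ A ⊗ Z) ≫
      X.X ◁ Y.X ◁ opM W.act Z) ≫ X.X ◁ (α_ Y.X W.X Z).inv ≫ (α_ _ _ _).inv := by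
      rw [opM_tensorAct, tA]; simp only [tensorObj, opM_tensorAct]
      simp only [opD, opB, opM]; monoidal
    have e2 : (α_ X.X Y.X W.X).hom ▷ (A ⊗ Z) ≫ opM (tensorAct X (tensorObj Y W)) Z =
      ((α_ (X.X ⊗ Y.X) W.X (A ⊗ Z)).hom ≫ (α_ X.X Y.X (W.X ⊗ A ⊗ Z)).hom) ≫
      (X.X ◁ Y.X ◁ W.X ◁ opD Δ Z ≫ X.X ◁ Y.X ◁ opB W.X A (A ⊗ Z) ≫
      X.X ◁ opB Y.X A (W.X ⊗ A ⊗ Z) ≫ opM X.act (Y.X ⊗ W.X ⊗ A ⊗ Z) ≫ X.X ◁ tA Y W Z) ≫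
      X.X ◁ (α_ Y.X W.X Z).inv ≫ (α_ _ _ _).inv := by
      rw [opM_tensorAct, tA]; simp only [tensorObj, opM_tensorAct, opB_tensor_left]
      simp only [opD, opB, opM]; monoidal
    exact e1.trans (((congrArg _ (congrArg (fun t => t ≫ _) (tA_assoc X Y W Z)))).trans e2.symm))
   (by
    refine (coactHom_iff _ _ _).2 fun Z => ?_
    have e1 : opD (tensorCoact (tensorObj X Y) W) Z ≫ (α_ X.X Y.X W.X).hom ▷ (A ⊗ Z) =
      ((α_ (X.X ⊗ Y.X) W.X Z).hom ≫ (α_ X.X Y.X (W.X ⊗ Z)).hom) ≫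
      (X.X ◁ Y.X ◁ opD W.coact Z ≫ tC X Y (W.X ⊗ A ⊗ Z) ≫ X.X ◁ Y.X ◁ opB A W.X (A ⊗ Z) ≫
      X.X ◁ Y.X ◁ W.X ◁ opM μ Z) ≫ X.X ◁ (α_ Y.X W.X (A ⊗ Z)).inv ≫ (α_ _ _ _).inv := by
      rw [opD_tensorCoact, tC]; simp only [tensorObj, opD_tensorCoact]
      simp only [opD, opB, opM]; monoidal
    have e2 : (α_ X.X Y.X W.X).hom ▷ Z ≫ opD (tensorCoact X (tensorObj Y W)) Z =
      ((α_ (X.X ⊗ Y.X) W.X Z).hom ≫ (α_ X.X Y.X (W.X ⊗ Z)).hom) ≫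
      (X.X ◁ tC Y W Z ≫ opD X.coact (Y.X ⊗ W.X ⊗ A ⊗ Z) ≫ X.X ◁ opB A Y.X (W.X ⊗ A ⊗ Z) ≫
      X.X ◁ Y.X ◁ opB A W.X (A ⊗ Z) ≫ X.X ◁ Y.X ◁ W.X ◁ opM μ Z) ≫
      X.X ◁ (α_ Y.X W.X (A ⊗ Z)).inv ≫ (α_ _ _ _).inv := by
      rw [opD_tensorCoact, tC]; simp only [tensorObj, opD_tensorCoact, opB_tensor_right]
      simp only [opD, opB, opM]; monoidal
    exact e2.trans ((congrArg _ (congrArg (fun t => t ≫ _) (tC_assoc X Y W Z))).symm.trans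
      e1.symm))

/-- The left unitor of right crossed modules. -/
def leftUnitor (X : CrossedModule A) : tensorObj tensorUnit X ≅ X :=
  mkIso (λ_ X.X) (by
    refine (actHom_iff _ _ _).2 fun Z => ?_
    have h1 : ∀ Z, opM ((λ_ A).hom ≫ ε) Z = (λ_ _).hom ≫ opE ε[A] Z ≫ (λ_ _).inv := fun Z => by
      simp only [opM, opE]; monoidal
    simp only [tensorObj, opM_tensorAct, tA, tensorUnit, h1]
    have := congrArg (fun t => X.X ◁ t) (counit_comul' (A := A) Z)
    simp only [whiskerLeft_comp, ← opE_B] at this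
    simp [reassoc_of% this])
   (by
    refine (coactHom_iff _ _ _).2 fun Z => ?_
    have h2 : ∀ Z, opD (η ≫ (λ_ A).inv) Z = (λ_ _).hom ≫ opU η[A] Z ≫ (λ_ _).inv := fun Z => by
      simp only [opD, opU]; monoidal
    simp only [tensorObj, opD_tensorCoact, tC, tensorUnit, h2]
    have := congrArg (fun t => X.X ◁ t) (one_mul' (A := A) Z)
    simp only [whiskerLeft_comp, ← opU_B] at this
    simp [reassoc_of% this])

/-- The right unitor of right crossed modules. -/
def rightUnitor (X : CrossedModule A) : tensorObj X tensorUnit ≅ X :=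
  mkIso (ρ_ X.X) (by
    refine (actHom_iff _ _ _).2 fun Z => ?_
    have h1 : ∀ Z, opM ((λ_ A).hom ≫ ε) Z = (λ_ _).hom ≫ opE ε[A] Z ≫ (λ_ _).inv := fun Z => by
      simp only [opM, opE]; monoidal
    simp only [tensorObj, opM_tensorAct, tA, tensorUnit, h1]
    have m : ∀ {P Q R : C} (t : P ⟶ Q) (r : X.X ⊗ Q ⟶ R),
        opM X.act P ≫ X.X ◁ t ≫ r = X.X ◁ A ◁ t ≫ opM X.act Q ≫ r :=
      fun t r => as22 (opM_tail X.act t) r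
    have := congrArg (fun t => X.X ◁ t) (comul_counit' (A := A) Z)
    simp only [whiskerLeft_comp, whiskerLeft_id] at this
    simp only [opB_unit_left, whiskerLeft_comp, Category.assoc, m, whiskerLeft_inv_hom_assoc,
      id_whiskerLeft]
    simp [reassoc_of% this]
    rw [as22 (opM_tail X.act (λ_ Z).inv).symm]
    simp)
   (by
    refine (coactHom_iff _ _ _).2 fun Z => ?_
    have h2 : ∀ Z, opD (η ≫ (λ_ A).inv) Z = (λ_ _).hom ≫ opU η[A] Z ≫ (λ_ _).inv := fun Z => by
      simp only [opD, opU]; monoidal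
    simp only [tensorObj, opD_tensorCoact, tC, tensorUnit, h2]
    have m : ∀ {P Q R : C} (t : P ⟶ Q) (r : X.X ⊗ A ⊗ Q ⟶ R),
        opD X.coact P ≫ X.X ◁ A ◁ t ≫ r = X.X ◁ t ≫ opD X.coact Q ≫ r :=
      fun t r => as22 (opD_tail X.coact t) r
    have := congrArg (fun t => X.X ◁ t) (mul_one' (A := A) Z)
    simp only [whiskerLeft_comp, whiskerLeft_id] at this
    simp only [opB_unit_right, whiskerLeft_comp, Category.assoc, ← m, whiskerLeft_inv_hom_assoc,
      id_whiskerLeft]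
    simp [reassoc_of% this]
    rw [this, Category.comp_id, opD_tail]
    simp)

instance : MonoidalCategoryStruct (CrossedModule A) where
  tensorObj := tensorObj
  tensorUnit := tensorUnit
  whiskerLeft X _ _ f := tensorHom (𝟙 X) f
  whiskerRight f Y := tensorHom f (𝟙 Y)
  tensorHom := tensorHom
  associator := associator
  leftUnitor := leftUnitor
  rightUnitor := rightUnitor

@[simp] lemma tensor_X (X Y : CrossedModule A) : (X ⊗ Y).X = X.X ⊗ Y.X := rfl
@[simp] lemma unit_X : (𝟙_ (CrossedModule A)).X = 𝟙_ C := rfl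
@[simp] lemma tensorHom_hom {X Y X' Y' : CrossedModule A} (f : X ⟶ X') (g : Y ⟶ Y') :
    (f ⊗ₘ g).hom = f.hom ⊗ₘ g.hom := rfl
@[simp] lemma whiskerLeft_hom (X : CrossedModule A) {Y Y' : CrossedModule A} (g : Y ⟶ Y') :
    (X ◁ g).hom = X.X ◁ g.hom := id_tensorHom _ _
@[simp] lemma whiskerRight_hom {X X' : CrossedModule A} (f : X ⟶ X') (Y : CrossedModule A) :
    (f ▷ Y).hom = f.hom ▷ Y.X := tensorHom_id _ _
@[simp] lemma associator_hom_hom (X Y W : CrossedModule A) :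
    (α_ X Y W).hom.hom = (α_ X.X Y.X W.X).hom := rfl
@[simp] lemma associator_inv_hom (X Y W : CrossedModule A) :
    (α_ X Y W).inv.hom = (α_ X.X Y.X W.X).inv := rfl
@[simp] lemma leftUnitor_hom_hom (X : CrossedModule A) : (λ_ X).hom.hom = (λ_ X.X).hom := rfl
@[simp] lemma leftUnitor_inv_hom (X : CrossedModule A) : (λ_ X).inv.hom = (λ_ X.X).inv := rfl
@[simp] lemma rightUnitor_hom_hom (X : CrossedModule A) : (ρ_ X).hom.hom = (ρ_ X.X).hom := rfl
@[simp] lemma rightUnitor_inv_hom (X : CrossedModule A) : (ρ_ X).inv.hom = (ρ_ X.X).inv := rfl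

instance : MonoidalCategory (CrossedModule A) where
  tensorHom_def _ _ := hom_ext' (by simp [MonoidalCategory.tensorHom_def])
  id_tensorHom_id _ _ := hom_ext' (by simp)
  tensorHom_comp_tensorHom _ _ _ _ := hom_ext' (by simp)
  whiskerLeft_id _ _ := hom_ext' (by simp)
  id_whiskerRight _ _ := hom_ext' (by simp)
  associator_naturality _ _ _ := hom_ext' (by simp)
  leftUnitor_naturality _ := hom_ext' (by simp)
  rightUnitor_naturality _ := hom_ext' (by simp)
  pentagon _ _ _ _ := hom_ext' (by simp)
  triangle _ _ := hom_ext' (by simp)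

end

section
variable {C : Type u} [Category.{v} C] [MonoidalCategory C] [BraidedCategory C]
variable {A : C}

section
variable [BimonObj A]

lemma hom_opM {X Y : CrossedModule A} (f : X ⟶ Y) (Z : C) :
    opM X.act Z ≫ f.hom ▷ Z = f.hom ▷ (A ⊗ Z) ≫ opM Y.act Z :=
  (actHom_iff _ _ _).1 f.act_hom Z
lemma hom_opD {X Y : CrossedModule A} (f : X ⟶ Y) (Z : C) :
    f.hom ▷ Z ≫ opD Y.coact Z = opD X.coact Z ≫ f.hom ▷ (A ⊗ Z) :=
  (coactHom_iff _ _ _).1 f.coact_hom Z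

lemma braid_natural_left {X Y : CrossedModule A} (f : X ⟶ Y) (W : CrossedModule A) :
    f.hom ▷ W.X ≫ braid Y W = braid X W ≫ W.X ◁ f.hom := by
  simp only [braid, Category.assoc, ← whiskerLeft_comp, Hom.act_hom]
  rw [← whisker_exchange_assoc, associator_inv_naturality_left_assoc, ← comp_whiskerRight_assoc,
    BraidedCategory.braiding_naturality_left, comp_whiskerRight_assoc,
    associator_naturality_middle_assoc, ← whiskerLeft_comp]
lemma braid_natural_right {X Y : CrossedModule A} (W : CrossedModule A) (f : X ⟶ Y) :
    W.X ◁ f.hom ≫ braid W Y = braid W X ≫ f.hom ▷ W.X := by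
  simp only [braid, Category.assoc, ← whiskerLeft_comp_assoc, Hom.coact_hom]
  rw [whisker_exchange, whiskerLeft_comp_assoc, associator_inv_naturality_middle_assoc,
    ← comp_whiskerRight_assoc, BraidedCategory.braiding_naturality_right,
    comp_whiskerRight_assoc, associator_naturality_left_assoc]

lemma braid_hexagon₁ (X Y W : CrossedModule A) :
    (α_ X.X Y.X W.X).hom ≫ braid X (Y ⊗ W) ≫ (α_ Y.X W.X X.X).hom =
      braid X Y ▷ W.X ≫ (α_ Y.X X.X W.X).hom ≫ Y.X ◁ braid X W := by
  refine cancel_tail fun Z => ?_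
  simp only [comp_whiskerRight, braid_tail X (Y ⊗ W) Z]
  have e1 : br X (Y ⊗ W) Z = X.X ◁ (α_ Y.X W.X Z).hom ≫ (X.X ◁ tC Y W Z ≫
      opB X.X Y.X (W.X ⊗ A ⊗ Z) ≫ Y.X ◁ opB X.X W.X (A ⊗ Z) ≫ Y.X ◁ W.X ◁ opM X.act Z) ≫
        (α_ Y.X W.X (X.X ⊗ Z)).inv := by
    have : (Y ⊗ W).coact = tensorCoact Y W := rfl
    simp only [br, tensor_X, this, opD_tensorCoact, opB_tensor_right]; simp
  have e2 : br X Y (W.X ⊗ Z) = (α_ _ _ _).inv ≫ braid X Y ▷ (W.X ⊗ Z) ≫ (α_ _ _ _).hom := by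
    rw [braid_tail]; simp
  have e3 : br X W Z = (α_ _ _ _).inv ≫ braid X W ▷ Z ≫ (α_ _ _ _).hom := by
    rw [braid_tail]; simp
  rw [e1, br_hex₁, e2, e3]
  simp only [tensor_X]
  monoidal

lemma braid_hexagon₂ (X Y W : CrossedModule A) :
    (α_ X.X Y.X W.X).inv ≫ braid (X ⊗ Y) W ≫ (α_ W.X X.X Y.X).inv =
      X.X ◁ braid Y W ≫ (α_ X.X W.X Y.X).inv ≫ braid X W ▷ Y.X := by
  refine cancel_tail fun Z => ?_
  simp only [comp_whiskerRight, braid_tail (X ⊗ Y) W Z]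
  have e1 : br (X ⊗ Y) W Z = (α_ X.X Y.X (W.X ⊗ Z)).hom ≫ (X.X ◁ Y.X ◁ opD W.coact Z ≫
      X.X ◁ opB Y.X W.X (A ⊗ Z) ≫ opB X.X W.X (Y.X ⊗ A ⊗ Z) ≫ W.X ◁ tA X Y Z) ≫
        W.X ◁ (α_ X.X Y.X Z).inv := by
    have : (X ⊗ Y).act = tensorAct X Y := rfl
    simp only [br, tensor_X, this, opM_tensorAct, opB_tensor_left]; simp
  have e2 : br X W (Y.X ⊗ Z) = (α_ _ _ _).inv ≫ braid X W ▷ (Y.X ⊗ Z) ≫ (α_ _ _ _).hom := by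
    rw [braid_tail]; simp
  have e3 : br Y W Z = (α_ _ _ _).inv ≫ braid Y W ▷ Z ≫ (α_ _ _ _).hom := by
    rw [braid_tail]; simp
  rw [e1, br_hex₂, e2, e3]
  simp only [tensor_X]
  monoidal

end

variable [HopfObj A] [IsIso 𝒮[A]]

/-- The underlying isomorphism of the braiding of right crossed modules. -/
noncomputable def braidIso (Y X : CrossedModule A) : Y.X ⊗ X.X ≅ X.X ⊗ Y.X where
  hom := braid Y X
  inv := braidInv Y X
  hom_inv_id := cancel_tail fun Z => by
    rw [comp_whiskerRight, braid_tail, braidInv_tail]; simp [reassoc_of% br_bri]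
  inv_hom_id := cancel_tail fun Z => by
    rw [comp_whiskerRight, braid_tail, braidInv_tail]; simp [reassoc_of% bri_br]

/-- The braiding of right crossed modules over a Hopf algebra with invertible antipode. -/
noncomputable def braiding (Y X : CrossedModule A) : Y ⊗ X ≅ X ⊗ Y :=
  mkIso (braidIso Y X) (by
    refine (actHom_iff _ _ _).2 fun Z => ?_
    have h : ∀ X Y : CrossedModule A, (X ⊗ Y).act = tensorAct X Y := fun _ _ => rfl
    simp only [braidIso, h, opM_tensorAct, braid_tail]
    simp only [Category.assoc, Iso.inv_hom_id_assoc, reassoc_of% tA_br])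
   (by
    refine (coactHom_iff _ _ _).2 fun Z => ?_
    have h : ∀ X Y : CrossedModule A, (X ⊗ Y).coact = tensorCoact X Y := fun _ _ => rfl
    simp only [braidIso, h, opD_tensorCoact, braid_tail]
    simp only [Category.assoc, Iso.inv_hom_id_assoc, reassoc_of% br_tC])

noncomputable instance : BraidedCategory (CrossedModule A) where
  braiding := braiding
  braiding_naturality_left f W := hom_ext' (by
    simpa [braiding, braidIso] using braid_natural_left f W)
  braiding_naturality_right W _ _ f := hom_ext' (by
    simpa [braiding, braidIso] using braid_natural_right W f)
  hexagon_forward X Y W := hom_ext' (by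
    simpa [braiding, braidIso] using braid_hexagon₁ X Y W)
  hexagon_reverse X Y W := hom_ext' (by
    simpa [braiding, braidIso] using braid_hexagon₂ X Y W)

@[simp] lemma braiding_hom_hom (Y X : CrossedModule A) : (β_ Y X).hom.hom = braid Y X := rfl

end

section
variable {C : Type u} [Category.{v} C] [MonoidalCategory C] [BraidedCategory C]

variable {A : C} [HopfObj A]

/-- The right adjoint action of a Hopf algebra on itself: `x ◁ h = S(h₁) x h₂`. -/
def adAct (A : C) [HopfObj A] : A ⊗ A ⟶ A :=
  A ◁ Δ[A] ≫ (α_ A A A).inv ≫ (β_ A A).hom ▷ A ≫ (α_ A A A).hom ≫ (𝒮[A] ⊗ₘ μ[A]) ≫ μ[A]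

lemma adM (Z : C) : opM (adAct A) Z =
    A ◁ opD Δ Z ≫ opB A A (A ⊗ Z) ≫ 𝒮[A] ▷ (A ⊗ A ⊗ Z) ≫ A ◁ opM μ Z ≫ opM μ Z := by
  rw [adAct, MonoidalCategory.tensorHom_def]; simp only [opD, opB, opM]; monoidal

lemma ad_one (Z : C) : A ◁ opU η Z ≫ opM (adAct A) Z = 𝟙 _ := by
  simp only [adM, Category.assoc]
  rw [as22 (wl22 _ (one_comul' _)) _, as21 (B_opU _) _, as21 (opU_S _) _, as22 (opU_tail _ _) _,
    as21 (mul_one' _) _]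
  rw [Category.id_comp, one_mul']

lemma ad_key (Z : C) : A ◁ opD Δ Z ≫ opB A A (A ⊗ Z) ≫ A ◁ opM (adAct A) Z ≫ opM μ Z =
    opM μ Z := by
  simp only [adM, Category.assoc, whiskerLeft_comp]
  rw [as22 (opB_tail _) _, as22 (wl22 _ (comul_assoc' _)) _, as32 (B_opD _) _, (mul_assoc' _).symm,
    as22 ((opM_tail _ _).symm) _]
  rw [reassoc_of% (opS_right (A := A))]
  try simp only [whiskerLeft_comp, Category.assoc]
  rw [as22 (opU_tail _ _) _, one_mul' _]
  rw [Category.comp_id]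
  try simp only [whiskerLeft_comp, Category.assoc]
  rw [as21 (opE_B _) _, as21 (wl21 _ (counit_comul' _)) _]
  simp

lemma ad_inv_F {X Z Z' : C} (f : X ⊗ A ⊗ Z ⟶ A ⊗ Z') :
    X ◁ opD Δ Z ≫ opB X A (A ⊗ Z) ≫ 𝒮[A] ▷ (X ⊗ A ⊗ Z) ≫
      A ◁ (X ◁ opD Δ Z ≫ opB X A (A ⊗ Z) ≫ A ◁ f ≫ opM μ Z') ≫ opM μ Z' = f := by
  simp only [Category.assoc, whiskerLeft_comp]
  rw [(mul_assoc' _).symm, as22 ((opM_tail μ[A] f).symm) _, as22 (opS_tail _ _) _,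
    as22 (opS_tail _ _) _, as22 (opB_tail _) _, as22 (wl22 _ (comul_assoc' _)) _, as32 (B_opD _) _]
  rw [reassoc_of% (opS_left (A := A))]
  try simp only [whiskerLeft_comp, Category.assoc]
  rw [as22 (opU_tail _ _) _, one_mul' _]
  rw [Category.comp_id]
  try simp only [whiskerLeft_comp, Category.assoc]
  rw [as21 (opE_B _) _, as21 (wl21 _ (counit_comul' _)) _]
  simp

lemma ad_inj {X Z Z' : C} {f g : X ⊗ A ⊗ Z ⟶ A ⊗ Z'}
    (h : X ◁ opD Δ Z ≫ opB X A (A ⊗ Z) ≫ A ◁ f ≫ opM μ Z' =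
      X ◁ opD Δ Z ≫ opB X A (A ⊗ Z) ≫ A ◁ g ≫ opM μ Z') : f = g := by
  rw [← ad_inv_F f, h, ad_inv_F]

lemma ad_inj₂ {X Y Z Z' : C} {f g : X ⊗ Y ⊗ A ⊗ Z ⟶ A ⊗ Z'}
    (h : X ◁ Y ◁ opD Δ Z ≫ X ◁ opB Y A (A ⊗ Z) ≫ opB X A (Y ⊗ A ⊗ Z) ≫ A ◁ f ≫ opM μ Z' =
      X ◁ Y ◁ opD Δ Z ≫ X ◁ opB Y A (A ⊗ Z) ≫ opB X A (Y ⊗ A ⊗ Z) ≫ A ◁ g ≫ opM μ Z') :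
    f = g := by
  rw [← cancel_epi (α_ X Y (A ⊗ Z)).hom]
  apply ad_inj
  simp only [opB_tensor_left, whiskerLeft_comp, Category.assoc, whiskerLeft_inv_hom_assoc]
  rw [associator_naturality_right_assoc, h, associator_naturality_right_assoc]

lemma ad_mul (Z : C) : opM (adAct A) (A ⊗ Z) ≫ opM (adAct A) Z =
    A ◁ opM μ Z ≫ opM (adAct A) Z := by
  simp only [adM, Category.assoc]
  rw [as25 (wl25 _ (bialg _)) _, as22 ((opB_tail (opM μ Z)).symm) _, as23 (B_opM μ[A]) _,
    as22 (opM_tail μ[A] (A ◁ opM μ Z)) _, as24 (opM_S _) _, as22 (opM_tail μ[A] (opM μ Z)) _]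
  conv_rhs => rw [mul_assoc']
  try simp only [whiskerLeft_comp, Category.assoc]
  rw [as22 (B_opS 𝒮[A]) _, as22 (opS_B 𝒮[A]) _]
  conv_rhs => rw [as22 (opB_tail (A ◁ opM μ Z)).symm]
  try simp only [whiskerLeft_comp, Category.assoc]
  rw [as22 (wl22 _ ((opS_tail 𝒮[A] (A ◁ opM μ Z)).symm)) _,
    as22 ((opS_tail 𝒮[A] (A ◁ A ◁ opM μ Z)).symm) _]
  rw [as22 (opM_tail μ[A] (opD Δ Z)) _, as22 (wl22 _ (opM_tail μ[A] (opD Δ Z))) _,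
    as22 (opS_tail _ (A ◁ A ◁ opD Δ Z)) _, as22 (opB_tail (A ◁ opD Δ Z)) _,
    as22 (wl22 _ (opD_tail _ (opD Δ Z))) _, as23 (opM_B μ[A]) _, as23 (wl23 _ (opM_B μ[A])) _,
    as22 ((opB_tail (opM μ (A ⊗ Z))).symm) _, as22 (opS_tail 𝒮[A] (A ◁ opB _ _ _)) _,
    as22 (opS_tail 𝒮[A] (opB _ _ _)) _, as22 (opS_B 𝒮[A]) _,
    as22 ((opS_tail 𝒮[A] (opM μ (A ⊗ Z))).symm) _,
    as22 ((opS_tail 𝒮[A] (A ◁ opM μ (A ⊗ Z))).symm) _, as22 (wl22 _ (mul_assoc' _)) _,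
    as22 (wl22 _ (wl22 _ (mul_assoc' _))) _, as22 (opB_tail (X := A) (opB A A (A ⊗ Z))) _]

lemma ad_compat (Z : C) : A ◁ opD Δ Z ≫ opB A A (A ⊗ Z) ≫ A ◁ opM (adAct A) Z ≫
      A ◁ opD Δ[A] Z ≫ opB A A (A ⊗ Z) ≫ A ◁ opM μ Z =
    A ◁ opD Δ Z ≫ opD Δ[A] (A ⊗ A ⊗ Z) ≫ A ◁ opB A A (A ⊗ Z) ≫
      opM (adAct A) (A ⊗ A ⊗ Z) ≫ A ◁ opM μ Z := by
  apply ad_inj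
  simp only [Category.assoc, whiskerLeft_comp]
  refine Eq.trans (b := opM μ Z ≫ opD Δ Z) ?_ (Eq.symm ?_)
  rw [as22 (opB_tail (opD Δ Z)) _, as22 (wl22 _ (comul_assoc' _)) _, as32 (B_opD Δ[A]) _,
    as22 (opD_tail _ (opM (adAct A) Z)) _, as22 (opD_tail _ (opD Δ Z)) _, (opM_tail _ _).symm]
  rw [← bialg, reassoc_of% ad_key]
  try simp only [whiskerLeft_comp, Category.assoc]
  rw [as22 (opB_tail (opD Δ Z)) _, as22 (wl22 _ (comul_assoc' _)) _, as23 ((opD_B Δ[A]).symm) _,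
    as22 (opB_tail (X := A) (opB A A (A ⊗ Z))) _, as22 ((opD_tail Δ[A] (opD Δ (A ⊗ Z))).symm) _,
    as32 (wl32 _ (B_opD Δ[A])) _, (opM_tail _ _).symm]
  rw [reassoc_of% ad_key, ← bialg]
  try simp only [whiskerLeft_comp, Category.assoc]

lemma ad_mul_hom (Z : C) :
  A ◁ A ◁ opD Δ Z ≫ A ◁ opB A A (A ⊗ Z) ≫ opM (adAct A) (A ⊗ A ⊗ Z) ≫ A ◁ opM (adAct A) Z ≫
    opM μ Z = opM μ (A ⊗ Z) ≫ opM (adAct A) Z := by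
  apply ad_inj₂
  simp only [Category.assoc, whiskerLeft_comp]
  refine Eq.trans (b := A ◁ opM μ Z ≫ opM μ Z) ?_ (Eq.symm ?_)
  rw [(mul_assoc' _).symm, as22 ((opM_tail μ[A] (opM (adAct A) _)).symm) _,
    as22 (opB_tail (A ◁ opD Δ Z)) _, as22 (wl22 _ (opB_tail (opD Δ Z))) _,
    as22 (wl22 _ (wl22 _ (comul_assoc' _))) _, as22 (opB_tail (opB _ _ _)) _,
    as32 (wl32 _ (B_opD Δ[A])) _]
  rw [reassoc_of% ad_key]
  try simp only [whiskerLeft_comp, Category.assoc]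
  rw [as22 (opM_tail μ[A] (opM (adAct A) _)) _, mul_assoc' _]
  have h := congrArg (fun t => A ◁ t) (ad_key (A := A) Z)
  simp only [whiskerLeft_comp] at h
  rw [reassoc_of% h]
  try simp only [whiskerLeft_comp, Category.assoc]
  rw [as32 ((opM_B μ[A]).symm) _, as22 ((opM_tail μ[A] (opD Δ _)).symm) _]
  rw [ad_key, mul_assoc']
  try simp only [whiskerLeft_comp, Category.assoc]

lemma ad_one_hom (Z : C) : opU η (A ⊗ Z) ≫ opM (adAct A) Z = opE ε Z ≫ opU η Z := by
  simp only [adM, Category.assoc]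
  rw [as22 (opU_tail _ _) _, as21 (opU_B _) _, as22 ((opS_tail 𝒮[A] (opU η _)).symm) _,
    as21 (wl21 _ (one_mul' _)) _]
  rw [whiskerLeft_id, Category.id_comp, opS_left]
  try simp only [whiskerLeft_comp, Category.assoc]

end

section
variable {C : Type u} [Category.{v} C] [MonoidalCategory C] [BraidedCategory C]
variable {A : C} [HopfObj A]

/-- The right coadjoint coaction of a Hopf algebra on itself: `x ↦ x₂ ⊗ S(x₁) x₃`. -/
def coadCoact (A : C) [HopfObj A] : A ⟶ A ⊗ A :=
  Δ[A] ≫ (𝒮[A] ⊗ₘ Δ[A]) ≫ (α_ A A A).inv ≫ (β_ A A).hom ▷ A ≫ (α_ A A A).hom ≫ A ◁ μ[A]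

lemma coadD (Z : C) : opD (coadCoact A) Z =
    opD Δ Z ≫ A ◁ opD Δ Z ≫ 𝒮[A] ▷ (A ⊗ A ⊗ Z) ≫ opB A A (A ⊗ Z) ≫ A ◁ opM μ Z := by
  rw [coadCoact, MonoidalCategory.tensorHom_def']; simp only [opD, opB, opM]; monoidal

lemma coad_counit (Z : C) : opD (coadCoact A) Z ≫ A ◁ opE ε Z = 𝟙 _ := by
  simp only [coadD, Category.assoc]
  rw [wl22 _ (mul_counit' _), as22 (opB_tail (opE ε Z)) _, B_opE _,
    as22 (opS_tail _ (A ◁ opE ε Z)) _, S_opE _, as21 (wl21 _ (comul_counit' _)) _]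
  rw [whiskerLeft_id, Category.id_comp, counit_comul']
  try simp only [whiskerLeft_comp, Category.assoc]

lemma coad_key (Z : C) : opD Δ Z ≫ A ◁ opD (coadCoact A) Z ≫ opB A A (A ⊗ Z) ≫ A ◁ opM μ Z =
    opD Δ Z := by
  simp only [coadD, Category.assoc, whiskerLeft_comp]
  rw [as22 ((opB_tail (opM μ Z)).symm) _, wl22 _ ((mul_assoc' _).symm), as32 ((opM_B μ[A]).symm) _,
    as22 (comul_assoc' _) _, as22 (opD_tail Δ[A] (opD Δ Z)) _]
  rw [reassoc_of% (opS_right (A := A))]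
  try simp only [whiskerLeft_comp, Category.assoc]
  rw [as22 ((opE_tail _ _).symm) _, as21 (counit_comul' _) _]
  rw [Category.id_comp]
  try simp only [whiskerLeft_comp, Category.assoc]
  rw [as21 (opU_B _) _, wl21 _ (one_mul' _)]
  simp

lemma coad_inv_F {X Z Z' : C} (f : A ⊗ Z' ⟶ X ⊗ A ⊗ Z) :
    opD Δ Z' ≫ A ◁ (opD Δ Z' ≫ A ◁ f ≫ opB A X (A ⊗ Z) ≫ X ◁ opM μ Z) ≫
      𝒮[A] ▷ (X ⊗ A ⊗ Z) ≫ opB A X (A ⊗ Z) ≫ X ◁ opM μ Z = f := by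
  simp only [Category.assoc, whiskerLeft_comp]
  rw [as22 (comul_assoc' _) _, as22 (opD_tail Δ[A] f) _,
    as22 ((opS_tail 𝒮[A] (X ◁ opM μ Z)).symm) _, as22 ((opS_tail 𝒮[A] (opB _ _ _)).symm) _,
    as22 ((opB_tail (opM μ Z)).symm) _, wl22 _ ((mul_assoc' _).symm), as32 ((opM_B μ[A]).symm) _]
  rw [reassoc_of% (opS_left (A := A))]
  try simp only [whiskerLeft_comp, Category.assoc]
  rw [as22 ((opE_tail _ _).symm) _, as21 (counit_comul' _) _]
  rw [Category.id_comp]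
  try simp only [whiskerLeft_comp, Category.assoc]
  rw [as21 (opU_B _) _, wl21 _ (one_mul' _)]
  simp

lemma coad_inj {X Z Z' : C} {f g : A ⊗ Z' ⟶ X ⊗ A ⊗ Z}
    (h : opD Δ Z' ≫ A ◁ f ≫ opB A X (A ⊗ Z) ≫ X ◁ opM μ Z =
      opD Δ Z' ≫ A ◁ g ≫ opB A X (A ⊗ Z) ≫ X ◁ opM μ Z) : f = g := by
  rw [← coad_inv_F f, h, coad_inv_F]

lemma coad_inj₂ {X Y Z Z' : C} {f g : A ⊗ Z' ⟶ X ⊗ Y ⊗ A ⊗ Z}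
    (h : opD Δ Z' ≫ A ◁ f ≫ opB A X (Y ⊗ A ⊗ Z) ≫ X ◁ opB A Y (A ⊗ Z) ≫ X ◁ Y ◁ opM μ Z =
      opD Δ Z' ≫ A ◁ g ≫ opB A X (Y ⊗ A ⊗ Z) ≫ X ◁ opB A Y (A ⊗ Z) ≫ X ◁ Y ◁ opM μ Z) :
    f = g := by
  rw [← cancel_mono (α_ X Y (A ⊗ Z)).inv]
  apply coad_inj
  simp only [opB_tensor_right, whiskerLeft_comp, Category.assoc, whiskerLeft_inv_hom_assoc]
  rw [← associator_inv_naturality_right, reassoc_of% h]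

lemma coad_comul (Z : C) : opD (coadCoact A) Z ≫ A ◁ opD Δ Z =
    opD (coadCoact A) Z ≫ opD (coadCoact A) (A ⊗ Z) := by
  simp only [coadD, Category.assoc]
  symm
  rw [wl25 _ (bialg _), as22 (opB_tail (opD Δ Z)) _, as23 ((opD_B Δ[A]).symm) _,
    as22 ((opD_tail Δ[A] (A ◁ opD Δ Z)).symm) _, as24 (S_opD _) _,
    as22 ((opD_tail Δ[A] (opD Δ Z)).symm) _]
  conv_rhs => rw [as22 (comul_assoc' _).symm]
  try simp only [whiskerLeft_comp, Category.assoc]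
  rw [as22 ((B_opS 𝒮[A]).symm) _, as22 ((opS_B 𝒮[A]).symm) _]
  conv_rhs => rw [as22 (opB_tail (A ◁ opD Δ Z))]
  try simp only [whiskerLeft_comp, Category.assoc]
  rw [as22 ((opD_tail Δ[A] (opM μ Z)).symm) _, as22 (wl22 _ ((opD_tail Δ[A] (opM μ Z)).symm)) _,
    as22 ((opS_tail 𝒮[A] (A ◁ A ◁ opM μ Z)).symm) _, as22 ((opB_tail (A ◁ opM μ Z)).symm) _,
    wl22 _ ((opM_tail _ (opM μ Z)).symm), as23 ((B_opD Δ[A]).symm) _,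
    as23 (wl23 _ ((B_opD Δ[A]).symm)) _, as22 (opB_tail (opD Δ (A ⊗ Z))) _,
    as22 (opS_tail 𝒮[A] (A ◁ A ◁ opD Δ Z)) _, as22 (wl22 _ (opS_tail 𝒮[A] (A ◁ opD Δ Z))) _,
    as22 ((opS_tail 𝒮[A] (A ◁ opB _ _ _)).symm) _, as22 ((opS_tail 𝒮[A] (opB _ _ _)).symm) _,
    as22 ((B_opS 𝒮[A]).symm) _, as22 (opS_tail 𝒮[A] (opD Δ (A ⊗ Z))) _,
    as22 (opS_tail 𝒮[A] (A ◁ opD Δ (A ⊗ Z))) _, as22 (opS_tail 𝒮[A] (𝒮[A] ▷ _)) _,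
    as22 (wl22 _ ((comul_assoc' _).symm)) _, as22 (wl22 _ (wl22 _ ((comul_assoc' _).symm))) _,
    as22 ((opB_tail (X := A) (opB A A (A ⊗ Z))).symm) _]

lemma coad_compat (Z : C) : A ◁ opD Δ Z ≫ opB A A (A ⊗ Z) ≫ A ◁ opM μ[A] Z ≫
      A ◁ opD (coadCoact A) Z ≫ opB A A (A ⊗ Z) ≫ A ◁ opM μ Z =
    A ◁ opD Δ Z ≫ opD (coadCoact A) (A ⊗ A ⊗ Z) ≫ A ◁ opB A A (A ⊗ Z) ≫
      opM μ[A] (A ⊗ A ⊗ Z) ≫ A ◁ opM μ Z := by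
  apply coad_inj
  simp only [Category.assoc, whiskerLeft_comp]
  refine Eq.trans (b := opM μ Z ≫ opD Δ Z) ?_ (Eq.symm ?_)
  rw [as22 ((opB_tail (opM μ Z)).symm) _, wl22 _ ((mul_assoc' _).symm), as32 ((opM_B μ[A]).symm) _,
    as22 ((opM_tail μ[A] (opD (coadCoact A) Z)).symm) _, as22 ((opM_tail μ[A] (opM μ Z)).symm) _,
    as22 (opD_tail Δ[A] (opD Δ Z)) _]
  rw [← reassoc_of% (bialg (A := A)), coad_key]
  try simp only [whiskerLeft_comp, Category.assoc]
  rw [as22 ((opB_tail (opM μ Z)).symm) _, wl22 _ ((mul_assoc' _).symm), as23 (B_opM μ[A]) _,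
    as22 ((opB_tail (X := A) (opB A A (A ⊗ Z))).symm) _, as22 (opM_tail μ[A] (opM μ (A ⊗ Z))) _,
    as32 (wl32 _ ((opM_B μ[A]).symm)) _, as22 (opD_tail Δ[A] (opD Δ Z)) _]
  rw [reassoc_of% coad_key, ← bialg]
  try simp only [whiskerLeft_comp, Category.assoc]

lemma coad_comul_hom (Z : C) :
  opD Δ Z ≫ A ◁ opD (coadCoact A) Z ≫ opD (coadCoact A) (A ⊗ A ⊗ Z) ≫ A ◁ opB A A (A ⊗ Z) ≫
    A ◁ A ◁ opM μ Z = opD (coadCoact A) Z ≫ opD Δ (A ⊗ Z) := by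
  apply coad_inj₂
  simp only [Category.assoc, whiskerLeft_comp]
  refine Eq.trans (b := opD Δ Z ≫ A ◁ opD Δ Z) ?_ (Eq.symm ?_)
  rw [as22 (comul_assoc' _) _, as22 (opD_tail Δ[A] (opD (coadCoact A) _)) _,
    as22 ((opB_tail (A ◁ opM μ Z)).symm) _, as22 (wl22 _ ((opB_tail (opM μ Z)).symm)) _,
    wl22 _ (wl22 _ ((mul_assoc' _).symm)), as22 ((opB_tail (X := A) (opB _ _ _)).symm) _,
    as32 (wl32 _ ((opM_B μ[A]).symm)) _]
  rw [reassoc_of% coad_key]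
  try simp only [whiskerLeft_comp, Category.assoc]
  rw [as22 ((opD_tail Δ[A] (opD (coadCoact A) _)).symm) _, as22 ((comul_assoc' _).symm) _]
  have h := congrArg (fun t => A ◁ t) (coad_key (A := A) Z)
  simp only [whiskerLeft_comp] at h
  rw [h]
  try simp only [whiskerLeft_comp, Category.assoc]
  rw [as32 (B_opD Δ[A]) _, opD_tail Δ[A] (opM μ Z)]
  rw [reassoc_of% coad_key, ← comul_assoc']
  try simp only [whiskerLeft_comp, Category.assoc]

lemma coad_counit_hom (Z : C) : opD (coadCoact A) Z ≫ opE ε (A ⊗ Z) = opE ε Z ≫ opU η Z := by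
  simp only [coadD, Category.assoc]
  rw [(opE_tail _ _).symm, as21 (opE_B _) _, as22 (opS_tail 𝒮[A] (opE ε _)) _,
    as21 (wl21 _ (counit_comul' _)) _]
  rw [whiskerLeft_id, Category.id_comp, opS_left]
  try simp only [whiskerLeft_comp, Category.assoc]

end

section
variable {C : Type u} [Category.{v} C] [MonoidalCategory C] [BraidedCategory C]

/-- `A_ad`: the Hopf algebra `A` as a right crossed module over itself, with the adjoint action
and with the comultiplication as coaction. -/
abbrev ad (A : C) [HopfObj A] : CrossedModule A where
  X := A
  act := adAct A
  coact := Δ[A]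
  act_one := (act_unit_iff _ _).2 ad_one
  act_mul := (act_assoc_iff _ _).2 ad_mul
  coact_counit := ComonObj.comul_counit A
  coact_comul := ComonObj.comul_assoc A
  compatibility := (compat_iff _ _ _ _).2 ad_compat

/-- `A^ad`: the Hopf algebra `A` as a right crossed module over itself, with the multiplication
as action and with the coadjoint coaction. -/
abbrev coad (A : C) [HopfObj A] : CrossedModule A where
  X := A
  act := μ[A]
  coact := coadCoact A
  act_one := MonObj.mul_one A
  act_mul := MonObj.mul_assoc A
  coact_counit := (coact_counit_iff _ _).2 coad_counit
  coact_comul := (coact_coassoc_iff _ _).2 coad_comul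
  compatibility := (compat_iff _ _ _ _).2 coad_compat

variable (A : C) [HopfObj A]

/-- The unit of `A` as a morphism of crossed modules. -/
def adOne : 𝟙_ (CrossedModule A) ⟶ ad A where
  hom := η[A]
  act_hom := by
    refine (actHom_iff _ _ _).2 fun Z => ?_
    have h1 : opM ((λ_ A).hom ≫ ε) Z ≫ η[A] ▷ Z = (λ_ _).hom ≫ opE ε[A] Z ≫ opU η Z := by
      simp only [opM, opE, opU]; monoidal
    have h2 : η[A] ▷ (A ⊗ Z) ≫ opM (adAct A) Z =
        (λ_ _).hom ≫ opU η (A ⊗ Z) ≫ opM (adAct A) Z := by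
      simp [opU]
    exact h1.trans ((congrArg _ (ad_one_hom Z).symm).trans h2.symm)
  coact_hom := by
    change η[A] ≫ Δ[A] = (η[A] ≫ (λ_ A).inv) ≫ η[A] ▷ A
    rw [BimonObj.one_comul, tensorObj.one_def, MonoidalCategory.tensorHom_def', Category.assoc,
      leftUnitor_inv_naturality_assoc]

/-- The multiplication of `A` as a morphism of crossed modules. -/
def adMul : ad A ⊗ ad A ⟶ ad A where
  hom := μ[A]
  act_hom := by
    refine (actHom_iff _ _ _).2 fun Z => ?_
    have h1 : opM (tensorAct (ad A) (ad A)) Z ≫ μ[A] ▷ Z =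
      (α_ _ _ _).hom ≫ tA (ad A) (ad A) Z ≫ opM μ Z := by
      rw [opM_tensorAct]; simp [opM]
    have h2 : μ[A] ▷ (A ⊗ Z) ≫ opM (adAct A) Z =
      (α_ _ _ _).hom ≫ opM μ (A ⊗ Z) ≫ opM (adAct A) Z := by simp [opM]
    refine h1.trans (Eq.trans ?_ h2.symm)
    rw [← ad_mul_hom, tA]
    simp only [Category.assoc]
  coact_hom := by
    change μ[A] ≫ Δ[A] = ((Δ[A] ⊗ₘ Δ[A]) ≫ tensorμ A A A A ≫ (A ⊗ A) ◁ μ[A]) ≫ μ[A] ▷ A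
    rw [BimonObj.mul_comul, MonoidalCategory.tensorHom_def' μ[A]]
    simp only [Category.assoc]

instance : MonObj (ad A) where
  one := adOne A
  mul := adMul A
  one_mul := hom_ext' (by
    simp only [comp_hom, whiskerLeft_hom, whiskerRight_hom, associator_hom_hom]
    exact MonObj.one_mul A)
  mul_one := hom_ext' (by
    simp only [comp_hom, whiskerLeft_hom, whiskerRight_hom, associator_hom_hom]
    exact MonObj.mul_one A)
  mul_assoc := hom_ext' (by
    simp only [comp_hom, whiskerLeft_hom, whiskerRight_hom, associator_hom_hom]
    exact MonObj.mul_assoc A)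

/-- The counit of `A` as a morphism of crossed modules. -/
def coadCounit : coad A ⟶ 𝟙_ (CrossedModule A) where
  hom := ε[A]
  act_hom := by
    change μ[A] ≫ ε[A] = ε[A] ▷ A ≫ (λ_ A).hom ≫ ε[A]
    rw [BimonObj.mul_counit, Comon.tensorObj_counit, MonoidalCategory.tensorHom_def, Category.assoc,
      leftUnitor_naturality]
  coact_hom := by
    refine (coactHom_iff _ _ _).2 fun Z => ?_
    have h1 : opD (η[A] ≫ (λ_ A).inv) Z = (λ_ _).hom ≫ opU η[A] Z ≫ (λ_ _).inv := by
      simp only [opD, opU]; monoidal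
    have h2 : ε[A] ▷ Z ≫ opD (η[A] ≫ (λ_ A).inv) Z = opE ε Z ≫ opU η Z ≫ (λ_ _).inv := by
      rw [h1]; simp [opE]
    have h3 : opD (coadCoact A) Z ≫ ε[A] ▷ (A ⊗ Z) =
        (opD (coadCoact A) Z ≫ opE ε (A ⊗ Z)) ≫ (λ_ _).inv := by
      simp [opE]
    refine h2.trans (Eq.trans ?_ h3.symm)
    rw [coad_counit_hom, Category.assoc]

/-- The comultiplication of `A` as a morphism of crossed modules. -/
def coadComul : coad A ⟶ coad A ⊗ coad A where
  hom := Δ[A]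
  act_hom := by
    change μ[A] ≫ Δ[A] = Δ[A] ▷ A ≫ (A ⊗ A) ◁ Δ[A] ≫ tensorμ A A A A ≫ (μ[A] ⊗ₘ μ[A])
    rw [BimonObj.mul_comul, MonoidalCategory.tensorHom_def Δ[A]]
    simp only [Category.assoc]
  coact_hom := by
    refine (coactHom_iff _ _ _).2 fun Z => ?_
    have h1 : Δ[A] ▷ Z ≫ opD (tensorCoact (coad A) (coad A)) Z =
      opD Δ Z ≫ tC (coad A) (coad A) Z ≫ (α_ _ _ _).inv := by
      rw [opD_tensorCoact]; simp [opD]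
    have h2 : opD (coadCoact A) Z ≫ Δ[A] ▷ (A ⊗ Z) =
      (opD (coadCoact A) Z ≫ opD Δ (A ⊗ Z)) ≫ (α_ _ _ _).inv := by simp [opD]
    refine h1.trans (Eq.trans ?_ h2.symm)
    rw [← coad_comul_hom, tC]
    simp only [Category.assoc]

instance : ComonObj (coad A) where
  counit := coadCounit A
  comul := coadComul A
  counit_comul := hom_ext' (by
    simp only [comp_hom, whiskerLeft_hom, whiskerRight_hom, associator_hom_hom]
    exact ComonObj.counit_comul A)
  comul_counit := hom_ext' (by
    simp only [comp_hom, whiskerLeft_hom, whiskerRight_hom, associator_hom_hom]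
    exact ComonObj.comul_counit A)
  comul_assoc := hom_ext' (by
    simp only [comp_hom, whiskerLeft_hom, whiskerRight_hom, associator_hom_hom]
    exact ComonObj.comul_assoc A)

end

section
variable {C : Type u} [Category.{v} C] [MonoidalCategory C] [BraidedCategory C]
variable {A : C} [BimonObj A]

/-- The algebra in `C` underlying an algebra in the category of crossed modules. -/
abbrev underlyingMonObj (X : CrossedModule A) [MonObj X] : MonObj X.X where
  one := η[X].hom
  mul := μ[X].hom
  one_mul := by
    simpa only [comp_hom, whiskerLeft_hom, whiskerRight_hom, associator_hom_hom,
      leftUnitor_hom_hom, rightUnitor_hom_hom, leftUnitor_inv_hom, rightUnitor_inv_hom] using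
      congrArg (fun f => f.hom) (MonObj.one_mul X)
  mul_one := by
    simpa only [comp_hom, whiskerLeft_hom, whiskerRight_hom, associator_hom_hom,
      leftUnitor_hom_hom, rightUnitor_hom_hom, leftUnitor_inv_hom, rightUnitor_inv_hom] using
      congrArg (fun f => f.hom) (MonObj.mul_one X)
  mul_assoc := by
    simpa only [comp_hom, whiskerLeft_hom, whiskerRight_hom, associator_hom_hom,
      leftUnitor_hom_hom, rightUnitor_hom_hom, leftUnitor_inv_hom, rightUnitor_inv_hom] using
      congrArg (fun f => f.hom) (MonObj.mul_assoc X)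

/-- The coalgebra in `C` underlying a coalgebra in the category of crossed modules. -/
abbrev underlyingComonObj (X : CrossedModule A) [ComonObj X] : ComonObj X.X where
  counit := ε[X].hom
  comul := Δ[X].hom
  counit_comul := by
    simpa only [comp_hom, whiskerLeft_hom, whiskerRight_hom, associator_hom_hom,
      leftUnitor_hom_hom, rightUnitor_hom_hom, leftUnitor_inv_hom, rightUnitor_inv_hom] using
      congrArg (fun f => f.hom) (ComonObj.counit_comul X)
  comul_counit := by
    simpa only [comp_hom, whiskerLeft_hom, whiskerRight_hom, associator_hom_hom,
      leftUnitor_hom_hom, rightUnitor_hom_hom, leftUnitor_inv_hom, rightUnitor_inv_hom] using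
      congrArg (fun f => f.hom) (ComonObj.comul_counit X)
  comul_assoc := by
    simpa only [comp_hom, whiskerLeft_hom, whiskerRight_hom, associator_hom_hom,
      leftUnitor_hom_hom, rightUnitor_hom_hom, leftUnitor_inv_hom, rightUnitor_inv_hom] using
      congrArg (fun f => f.hom) (ComonObj.comul_assoc X)

end

end CrossedModule

/-!
The proof avoids string-diagram computations by moving as much as possible into the braided
category `D` of crossed modules. Write `H = A ⊗ B` with the given multiplication and
comultiplication, `i : A ⟶ H` and `j : B ⟶ H` for the two inclusions, which are monoid morphisms
because they come from the inclusions of the factors of `A_ad ⊗ B` in `D`.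

The comultiplication is multiplicative. In elements, `Δ(a ⊗ b) = a₁ ⊗ b₁₀ ⊗ a₂ b₁₁ ⊗ b₂`, which
is the product in the tensor product algebra `H ⊗ H` of `δ(a ⊗ b₁)` and `1 ⊗ j(b₂)`, where `δ` is
the coaction of the crossed module `A_ad ⊗ B` followed by `id ⊗ i` (`bosonization.comul_eq`).
The map `δ` is a monoid morphism since `A_ad ⊗ B` is an algebra in `D`, in particular a comodule
algebra, and `b ↦ 1 ⊗ j(b)` is one too. The two commute up to the braiding of `D`: the relation
`j(b) i(a) = i(a₁) j(b ◁ a₂)` and coassociativity give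
`(1 ⊗ j(b)) δ(h) = δ(h₀) (1 ⊗ j(b ◁ h₁))` (`bosonization.inrB₂_mul_coactionInl`). Hence their
product is a monoid morphism on the algebra `(A_ad ⊗ B) ⊗ B` of `D`, by the general criterion
`isMonHom_tensor_of_braid`. Precomposing with `A_ad ⊗ Δ_B`, which is a morphism of algebras in `D`,
gives the claim. The counit is treated by the same criterion.

The antipode. Let `p : H ⟶ A` and `q : H ⟶ B` be the projections, which are comonoid morphisms.
In the convolution monoid of endomorphisms of `H` the identity is the product `(p ≫ i) * (q ≫ j)`,
the factors have the inverses `p ≫ S_A ≫ i` and `q ≫ S_B ≫ j`, and the product of these inverses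
in the opposite order is the antipode of the theorem. It is invertible as a composite of braidings
of `D` and antipodes.
-/

namespace Strand

/-! ### Monoids and comonoids in a braided category -/

section
variable {C : Type u} [Category.{v} C] [MonoidalCategory C]

lemma mul_four {K : C} [MonObj K] : (μ[K] ⊗ₘ μ[K]) ≫ μ =
    (α_ K K (K ⊗ K)).hom ≫ K ◁ ((α_ K K K).inv ≫ μ ▷ K ≫ μ) ≫ μ := by
  rw [MonObj.mul_assoc, Iso.inv_hom_id_assoc, MonoidalCategory.tensorHom_def', Category.assoc,
    MonObj.mul_assoc]
  simp

/-- If `g(y) f(x)` can be rewritten as `f(x') g(y')` with `x' ⊗ y' = b(y ⊗ x)`, then the map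
`x ⊗ y ↦ f(x) g(y)` is multiplicative for the multiplication on `X ⊗ Y` twisted by `b`. -/
lemma mul_exchange {K X Y : C} [MonObj K] {f : X ⟶ K} {g : Y ⟶ K} {b : Y ⊗ X ⟶ X ⊗ Y}
    (hb : (g ⊗ₘ f) ≫ μ = b ≫ (f ⊗ₘ g) ≫ μ) :
    (α_ X Y (X ⊗ Y)).hom ≫ X ◁ (α_ Y X Y).inv ≫ X ◁ b ▷ Y ≫ X ◁ (α_ X Y Y).hom ≫
        (α_ X X (Y ⊗ Y)).inv ≫ ((f ⊗ₘ f) ≫ μ ⊗ₘ (g ⊗ₘ g) ≫ μ) ≫ μ[K] =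
      ((f ⊗ₘ g) ≫ μ ⊗ₘ (f ⊗ₘ g) ≫ μ) ≫ μ[K] := by
  have e : ∀ {P Q : C} (p : P ⟶ K ⊗ K) (q : Q ⟶ K ⊗ K),
      (p ≫ μ ⊗ₘ q ≫ μ) ≫ μ[K] =
        (p ⊗ₘ q) ≫ (α_ K K (K ⊗ K)).hom ≫ K ◁ ((α_ K K K).inv ≫ μ ▷ K ≫ μ) ≫ μ := by
    intro P Q p q
    rw [← mul_four, ← tensorHom_comp_tensorHom, Category.assoc]
  -- A fourfold product, bracketed so that the two inner factors are multiplied first.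
  have n : ∀ {P Q R S : C} (p : P ⟶ K) (q : Q ⟶ K) (r : R ⟶ K) (s : S ⟶ K),
      ((p ⊗ₘ q) ⊗ₘ (r ⊗ₘ s)) ≫ (α_ K K (K ⊗ K)).hom ≫ K ◁ ((α_ K K K).inv ≫ μ ▷ K ≫ μ) ≫ μ =
      (α_ P Q (R ⊗ S)).hom ≫ P ◁ (α_ Q R S).inv ≫ (p ⊗ₘ (((q ⊗ₘ r) ≫ μ) ⊗ₘ s) ≫ μ) ≫ μ := by
    intro P Q R S p q r s
    have h : ((q ⊗ₘ r) ≫ μ[K]) ⊗ₘ s = ((q ⊗ₘ r) ⊗ₘ s) ≫ μ ▷ K := by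
      rw [← tensorHom_id, tensorHom_comp_tensorHom, Category.comp_id]
    rw [h]
    simp only [MonoidalCategory.tensorHom_def, whiskerLeft_comp, Category.assoc, comp_whiskerRight]
    monoidal
  rw [e, e, n, n, hb]
  simp only [Iso.inv_hom_id_assoc, whiskerLeft_hom_inv_assoc]
  congr 2
  rw [← id_tensorHom, tensorHom_comp_tensorHom_assoc, Category.id_comp,
    ← tensorHom_id, tensorHom_comp_tensorHom_assoc, Category.id_comp]

/-- The inclusion of the second factor of `M ⊗ N`, by the unit of the monoid `M`. -/
def inr (M N : C) [MonObj M] : N ⟶ M ⊗ N := (λ_ N).inv ≫ η[M] ▷ N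
/-- The inclusion of the first factor of `M ⊗ N`, by the unit of the monoid `N`. -/
def inl (M N : C) [MonObj N] : M ⟶ M ⊗ N := (ρ_ M).inv ≫ M ◁ η[N]
/-- The projection of `M ⊗ N` to its first factor, by the counit of the comonoid `N`. -/
def fst (M N : C) [ComonObj N] : M ⊗ N ⟶ M := M ◁ ε[N] ≫ (ρ_ M).hom
/-- The projection of `M ⊗ N` to its second factor, by the counit of the comonoid `M`. -/
def snd (M N : C) [ComonObj M] : M ⊗ N ⟶ N := ε[M] ▷ N ≫ (λ_ N).hom

lemma comp_inr {M N Z : C} [MonObj M] (w : Z ⟶ N) :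
    w ≫ inr M N = (λ_ Z).inv ≫ (η[M] ⊗ₘ w) := by
  simp [inr, MonoidalCategory.tensorHom_def']

/-- A morphism `f : M ⟶ N`, regarded as an element of the convolution monoid. -/
def toConv {M N : C} (f : M ⟶ N) : Conv M N := f

lemma toConv_mul {M N : C} [ComonObj M] [MonObj N] (f g : M ⟶ N) :
    toConv f * toConv g = toConv (Δ ≫ (f ⊗ₘ g) ≫ μ) := by
  rw [MonoidalCategory.tensorHom_def, Category.assoc]; rfl

lemma toConv_one {M N : C} [ComonObj M] [MonObj N] :
    (1 : Conv M N) = toConv (ε ≫ η) := rfl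

/-- Transport of a convolution identity `x * y = 1` on `P` along a comonoid morphism into `P` and
a monoid morphism out of `P`. -/
lemma conv_inverse {H P K : C} [ComonObj H] [ComonObj P] [MonObj P] [MonObj K]
    (p : H ⟶ P) [IsComonHom p] (i : P ⟶ K) [IsMonHom i] {x y : P ⟶ P}
    (h : Δ ≫ (x ⊗ₘ y) ≫ μ = ε ≫ η) :
    toConv (p ≫ x ≫ i) * toConv (p ≫ y ≫ i) = 1 := by
  have := congrArg (fun t => p ≫ t ≫ i) h
  simp only [Category.assoc, IsMonHom.mul_hom, IsMonHom.one_hom, IsComonHom.hom_comul_assoc,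
    IsComonHom.hom_counit_assoc, tensorHom_comp_tensorHom_assoc] at this
  rw [toConv_mul, toConv_one, ← this]

end

section
variable {C : Type u} [Category.{v} C] [MonoidalCategory C] [BraidedCategory C]
variable {M N : C} [MonObj M] [MonObj N] {X Y Z : C}

instance : IsMonHom η[M] where
  mul_hom := by simp [MonoidalCategory.tensorHom_def, unitors_equal]

instance : IsMonHom (inr M N) := inferInstanceAs (IsMonHom ((λ_ N).inv ≫ η[M] ▷ N))
instance : IsMonHom (inl M N) := inferInstanceAs (IsMonHom ((ρ_ M).inv ≫ M ◁ η[N]))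

lemma tensorμ_unit_right (X Y Z : C) : (X ⊗ Y) ◁ (λ_ Z).inv ≫ tensorμ X Y (𝟙_ C) Z ≫
    (ρ_ X).hom ▷ (Y ⊗ Z) = (α_ X Y Z).hom := by
  simp only [tensorμ, braiding_tensorUnit_right]; monoidal

lemma tensorμ_unit_left (X Y Z : C) : (λ_ Z).inv ▷ (X ⊗ Y) ≫ tensorμ (𝟙_ C) Z X Y ≫
    (λ_ X).hom ▷ (Z ⊗ Y) = (α_ Z X Y).inv ≫ (β_ Z X).hom ▷ Y ≫ (α_ X Z Y).hom := by
  simp only [tensorμ]; monoidal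

lemma mul_inr (u : X ⟶ M) (v : Y ⟶ N) (w : Z ⟶ N) :
    ((u ⊗ₘ v) ⊗ₘ (w ≫ inr M N)) ≫ μ = (α_ X Y Z).hom ≫ (u ⊗ₘ (v ⊗ₘ w) ≫ μ) := by
  have h : ((u ⊗ₘ v) ⊗ₘ (w ≫ inr M N)) =
      (X ⊗ Y) ◁ (λ_ Z).inv ≫ ((u ⊗ₘ v) ⊗ₘ (η[M] ⊗ₘ w)) := by
    rw [comp_inr, ← id_tensorHom, tensorHom_comp_tensorHom, Category.id_comp]
  rw [h, tensorObj.mul_def, Category.assoc, tensorμ_natural_assoc, tensorHom_comp_tensorHom,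
    MonoidalCategory.tensorHom_def u, Category.assoc, MonObj.mul_one, rightUnitor_naturality,
    ← tensorμ_unit_right]
  simp [MonoidalCategory.tensorHom_def]

lemma inr_mul (u : X ⟶ M) (v : Y ⟶ N) (w : Z ⟶ N) :
    ((w ≫ inr M N) ⊗ₘ (u ⊗ₘ v)) ≫ μ =
      (α_ Z X Y).inv ≫ (β_ Z X).hom ▷ Y ≫ (α_ X Z Y).hom ≫ (u ⊗ₘ (w ⊗ₘ v) ≫ μ) := by
  have h : ((w ≫ inr M N) ⊗ₘ (u ⊗ₘ v)) =
      (λ_ Z).inv ▷ (X ⊗ Y) ≫ ((η[M] ⊗ₘ w) ⊗ₘ (u ⊗ₘ v)) := by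
    rw [comp_inr, ← tensorHom_id, tensorHom_comp_tensorHom, Category.id_comp]
  have := reassoc_of% (tensorμ_unit_left X Y Z)
  rw [h, tensorObj.mul_def, Category.assoc, tensorμ_natural_assoc, tensorHom_comp_tensorHom,
    MonoidalCategory.tensorHom_def' _ u, Category.assoc, MonObj.one_mul, leftUnitor_naturality,
    ← this]
  simp [MonoidalCategory.tensorHom_def]

lemma inl_mul_inr (M N : C) [MonObj M] [MonObj N] : (inl M N ⊗ₘ inr M N) ≫ μ = 𝟙 (M ⊗ N) := by
  have h : inl M N = (ρ_ M).inv ≫ (𝟙 M ⊗ₘ η[N]) := by simp [inl]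
  have := mul_inr (𝟙 M) η[N] (𝟙 N)
  rw [Category.id_comp] at this
  rw [h, ← Category.id_comp (inr M N), ← tensorHom_comp_tensorHom, Category.assoc, this]
  simp

lemma inr_mul_inl (M N : C) [MonObj M] [MonObj N] :
    (inr M N ⊗ₘ inl M N) ≫ μ = (β_ N M).hom := by
  have h : inl M N = (ρ_ M).inv ≫ (𝟙 M ⊗ₘ η[N]) := by simp [inl]
  have := inr_mul (𝟙 M) η[N] (𝟙 N)
  rw [Category.id_comp] at this
  rw [h, ← Category.id_comp (inr M N), ← tensorHom_comp_tensorHom, Category.assoc, this]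
  simp

lemma comp_mul_inr (c : M ⟶ M ⊗ Y) (v : Y ⟶ N) (w : Z ⟶ N) :
    (c ≫ M ◁ v ⊗ₘ w ≫ inr M N) ≫ μ = c ▷ Z ≫ (α_ M Y Z).hom ≫ M ◁ ((v ⊗ₘ w) ≫ μ) := by
  have h := mul_inr (𝟙 M) v w
  simp only [id_tensorHom] at h
  rw [← h, ← tensorHom_id, tensorHom_comp_tensorHom_assoc, Category.id_comp]

lemma inr_mul_comp (c : M ⟶ M ⊗ Y) (v : Y ⟶ N) (w : Z ⟶ N) :
    (w ≫ inr M N ⊗ₘ c ≫ M ◁ v) ≫ μ =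
      Z ◁ c ≫ (α_ Z M Y).inv ≫ (β_ Z M).hom ▷ Y ≫ (α_ M Z Y).hom ≫ M ◁ ((w ⊗ₘ v) ≫ μ) := by
  have h := inr_mul (𝟙 M) v w
  simp only [id_tensorHom] at h
  rw [← h, ← id_tensorHom Z c, tensorHom_comp_tensorHom_assoc, Category.id_comp]

end

section
variable {C : Type u} [Category.{v} C] [MonoidalCategory C] [BraidedCategory C]
variable (M N : C) [ComonObj M] [ComonObj N]

lemma comul_proj {P Q R S : C} (p : M ⟶ P) (q : N ⟶ Q) (r : M ⟶ R) (s : N ⟶ S) :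
    Δ[M ⊗ N] ≫ ((p ⊗ₘ q) ⊗ₘ (r ⊗ₘ s)) =
      (Δ ≫ (p ⊗ₘ r) ⊗ₘ Δ ≫ (q ⊗ₘ s)) ≫ tensorμ P R Q S := by
  rw [Comon.tensorObj_comul, Category.assoc, ← tensorμ_natural, tensorHom_comp_tensorHom_assoc]

lemma tensorμ_unit_mid (X Y : C) : ((ρ_ X).inv ⊗ₘ (λ_ Y).inv) ≫ tensorμ X (𝟙_ C) (𝟙_ C) Y ≫
    ((ρ_ X).hom ⊗ₘ (λ_ Y).hom) = 𝟙 _ := by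
  simp only [tensorμ, braiding_tensorUnit_right]; monoidal

lemma tensorμ_unit_outer (X Y : C) : ((λ_ X).inv ⊗ₘ (ρ_ Y).inv) ≫ tensorμ (𝟙_ C) X Y (𝟙_ C) ≫
    ((λ_ Y).hom ⊗ₘ (ρ_ X).hom) = (β_ X Y).hom := by
  simp only [tensorμ]; monoidal

lemma comul_fst_snd : Δ[M ⊗ N] ≫ (fst M N ⊗ₘ snd M N) = 𝟙 _ := by
  have h : (fst M N ⊗ₘ snd M N) = ((𝟙 M ⊗ₘ ε[N]) ⊗ₘ (ε[M] ⊗ₘ 𝟙 N)) ≫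
    ((ρ_ M).hom ⊗ₘ (λ_ N).hom) := by simp [fst, snd, ← tensorHom_comp_tensorHom]
  rw [h, ← Category.assoc, comul_proj, id_tensorHom, tensorHom_id, comul_counit, counit_comul,
    Category.assoc, tensorμ_unit_mid]

lemma comul_snd_fst : Δ[M ⊗ N] ≫ (snd M N ⊗ₘ fst M N) = (β_ M N).hom := by
  have h : (snd M N ⊗ₘ fst M N) = ((ε[M] ⊗ₘ 𝟙 N) ⊗ₘ (𝟙 M ⊗ₘ ε[N])) ≫
    ((λ_ N).hom ⊗ₘ (ρ_ M).hom) := by simp [fst, snd, ← tensorHom_comp_tensorHom]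
  rw [h, ← Category.assoc, comul_proj, id_tensorHom, tensorHom_id, comul_counit, counit_comul,
    Category.assoc, tensorμ_unit_outer]

instance : IsComonHom (fst M N) where
  hom_counit := by simp [fst, MonoidalCategory.tensorHom_def', unitors_equal]
  hom_comul := by
    have h : (fst M N ⊗ₘ fst M N) = ((𝟙 M ⊗ₘ ε[N]) ⊗ₘ (𝟙 M ⊗ₘ ε[N])) ≫
      ((ρ_ M).hom ⊗ₘ (ρ_ M).hom) := by simp [fst, ← tensorHom_comp_tensorHom]
    rw [h, ← Category.assoc, comul_proj, MonoidalCategory.tensorHom_def' ε[N], ← Category.assoc,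
      comul_counit]
    have : tensorμ M M (𝟙_ C) (𝟙_ C) ≫ ((ρ_ M).hom ⊗ₘ (ρ_ M).hom) =
      (M ⊗ M) ◁ (ρ_ _).hom ≫ (ρ_ _).hom := by
      simp only [tensorμ, braiding_tensorUnit_right]; monoidal
    rw [Category.assoc, this, id_tensorHom_id, Category.comp_id]
    simp [fst, MonoidalCategory.tensorHom_def']

instance : IsComonHom (snd M N) where
  hom_counit := by simp [snd, MonoidalCategory.tensorHom_def]
  hom_comul := by
    have h : (snd M N ⊗ₘ snd M N) = ((ε[M] ⊗ₘ 𝟙 N) ⊗ₘ (ε[M] ⊗ₘ 𝟙 N)) ≫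
      ((λ_ N).hom ⊗ₘ (λ_ N).hom) := by simp [snd, ← tensorHom_comp_tensorHom]
    rw [h, ← Category.assoc, comul_proj, MonoidalCategory.tensorHom_def ε[M], ← Category.assoc,
      counit_comul]
    have : tensorμ (𝟙_ C) (𝟙_ C) N N ≫ ((λ_ N).hom ⊗ₘ (λ_ N).hom) =
      (λ_ _).hom ▷ (N ⊗ N) ≫ (λ_ _).hom := by
      simp only [tensorμ, braiding_tensorUnit_left]; monoidal
    rw [Category.assoc, this, id_tensorHom_id, Category.comp_id]
    simp [snd, MonoidalCategory.tensorHom_def]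

end

section
variable {C : Type u} [Category.{v} C] [MonoidalCategory C] [BraidedCategory C]
variable (X : C) [BimonObj X]

instance : IsMonHom Δ[X] := ⟨BimonObj.one_comul X, by simp [tensorObj.mul_def]⟩
instance : IsMonHom ε[X] := ⟨by simp [BimonObj.one_counit], by simp [BimonObj.mul_counit]⟩

end

end Strand

namespace CrossedModule
open Strand
variable {C : Type u} [Category.{v} C] [MonoidalCategory C] [BraidedCategory C]

/-! ### Monoids in crossed modules and their underlying monoids -/

section
variable {A : C} [BimonObj A]

/-- An algebra in crossed modules is a comodule algebra: its coaction is a monoid morphism into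
the tensor product algebra in `C`. -/
lemma isMonHom_coact (X : CrossedModule A) [MonObj X] :
    letI := underlyingMonObj X
    IsMonHom X.coact := by
  let := underlyingMonObj X
  refine ⟨?_, ?_⟩
  · have h : η[X].hom ≫ X.coact = (η[A] ≫ (λ_ A).inv) ≫ η[X].hom ▷ A := η[X].coact_hom
    refine h.trans ?_
    rw [tensorObj.one_def]
    change _ = (λ_ (𝟙_ C)).inv ≫ (η[X].hom ⊗ₘ η[A])
    simp [MonoidalCategory.tensorHom_def']
  · have h : μ[X].hom ≫ X.coact = tensorCoact X X ≫ μ[X].hom ▷ A := μ[X].coact_hom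
    refine h.trans ?_
    rw [tensorObj.mul_def, tensorCoact, Category.assoc, Category.assoc]
    change _ = _ ≫ _ ≫ (μ[X].hom ⊗ₘ μ[A])
    rw [MonoidalCategory.tensorHom_def' μ[X].hom]
    rfl

lemma isMonHom_underlying {X Y : CrossedModule A} [MonObj X] [MonObj Y] (f : X ⟶ Y) [IsMonHom f] :
    letI := underlyingMonObj X
    letI := underlyingMonObj Y
    IsMonHom f.hom := by
  let := underlyingMonObj X
  let := underlyingMonObj Y
  exact ⟨congrArg Hom.hom (IsMonHom.one_hom f), congrArg Hom.hom (IsMonHom.mul_hom f)⟩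

lemma isComonHom_underlying {X Y : CrossedModule A} [ComonObj X] [ComonObj Y] (f : X ⟶ Y)
    [IsComonHom f] :
    letI := underlyingComonObj X
    letI := underlyingComonObj Y
    IsComonHom f.hom := by
  let := underlyingComonObj X
  let := underlyingComonObj Y
  exact ⟨congrArg Hom.hom (IsComonHom.hom_counit f), congrArg Hom.hom (IsComonHom.hom_comul f)⟩

/-- In elements: `y ⊗ x ↦ x₀ ⊗ x₁ ⊗ (y ◁ x₂)`, computed in two ways. The second way is the braiding
of `C` followed by the braiding of `Y` with `A`, the latter coacting on itself by `Δ`. -/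
lemma braid_coact (Y X : CrossedModule A) :
    braid Y X ≫ X.coact ▷ Y.X ≫ (α_ X.X A Y.X).hom =
      Y.X ◁ X.coact ≫ (α_ Y.X X.X A).inv ≫ (β_ Y.X X.X).hom ▷ A ≫ (α_ X.X Y.X A).hom ≫
        X.X ◁ (Y.X ◁ Δ[A] ≫ (α_ Y.X A A).inv ≫ (β_ Y.X A).hom ▷ A ≫ (α_ A Y.X A).hom ≫
          A ◁ Y.act) := by
  refine cancel_tail fun Z => ?_
  have e1 : (braid Y X ≫ X.coact ▷ Y.X ≫ (α_ X.X A Y.X).hom) ▷ Z =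
      (α_ _ _ _).hom ≫ (br Y X Z ≫ opD X.coact (Y.X ⊗ Z)) ≫
        X.X ◁ (α_ _ _ _).inv ≫ (α_ _ _ _).inv := by
    rw [comp_whiskerRight, braid_tail]; simp only [opD]; monoidal
  have e2 : (Y.X ◁ X.coact ≫ (α_ Y.X X.X A).inv ≫ (β_ Y.X X.X).hom ▷ A ≫ (α_ X.X Y.X A).hom ≫
        X.X ◁ (Y.X ◁ Δ[A] ≫ (α_ Y.X A A).inv ≫ (β_ Y.X A).hom ▷ A ≫ (α_ A Y.X A).hom ≫
          A ◁ Y.act)) ▷ Z =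
      (α_ _ _ _).hom ≫ (Y.X ◁ opD X.coact Z ≫ opB Y.X X.X (A ⊗ Z) ≫ X.X ◁ Y.X ◁ opD Δ Z ≫
        X.X ◁ opB Y.X A (A ⊗ Z) ≫ X.X ◁ A ◁ opM Y.act Z) ≫
        X.X ◁ (α_ _ _ _).inv ≫ (α_ _ _ _).inv := by
    simp only [opD, opB, opM]; monoidal
  rw [e1, e2]
  congr 2
  rw [br, Category.assoc, Category.assoc, ← opD_tail, as22 (opB_tail (opD Δ Z)) _,
    as22 (wl22 _ (X.rn_comul Z)) _, as32 (B_opD X.coact) _]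

end

variable {A : C} [HopfObj A] [IsIso 𝒮[A]]

/-- Universal property of a tensor product algebra of crossed modules, with values in an algebra
of `C`: monoid morphisms `f` and `g` that commute up to the braiding of crossed modules combine to
a monoid morphism `x ⊗ y ↦ f(x) g(y)`. -/
lemma isMonHom_tensor_of_braid {X Y : CrossedModule A} [MonObj X] [MonObj Y] {K : C} [MonObj K]
    {f : X.X ⟶ K} {g : Y.X ⟶ K}
    (hf : letI := underlyingMonObj X; IsMonHom f) (hg : letI := underlyingMonObj Y; IsMonHom g)
    (h : (g ⊗ₘ f) ≫ μ = braid Y X ≫ (f ⊗ₘ g) ≫ μ) :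
    letI := underlyingMonObj (X ⊗ Y)
    IsMonHom (M := (X ⊗ Y).X) ((f ⊗ₘ g) ≫ μ[K]) := by
  let := underlyingMonObj X
  let := underlyingMonObj Y
  let := underlyingMonObj (X ⊗ Y)
  have f1 : η[X].hom ≫ f = η := hf.one_hom
  have g1 : η[Y].hom ≫ g = η := hg.one_hom
  have f2 : μ[X].hom ≫ f = (f ⊗ₘ f) ≫ μ := hf.mul_hom
  have g2 : μ[Y].hom ≫ g = (g ⊗ₘ g) ≫ μ := hg.mul_hom
  refine ⟨?_, ?_⟩
  · change ((λ_ (𝟙_ C)).inv ≫ (η[X].hom ⊗ₘ η[Y].hom)) ≫ (f ⊗ₘ g) ≫ μ[K] = _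
    rw [Category.assoc, tensorHom_comp_tensorHom_assoc, f1, g1, MonoidalCategory.tensorHom_def,
      Category.assoc, MonObj.mul_one]
    simp [← unitors_equal]
  · rw [← mul_exchange h, ← f2, ← g2, ← tensorHom_comp_tensorHom_assoc]
    change (tensorμ X Y X Y ≫ (μ[X] ⊗ₘ μ[Y])).hom ≫ _ = _
    simp only [tensorμ, comp_hom, associator_hom_hom, associator_inv_hom, whiskerLeft_hom,
      whiskerRight_hom, tensorHom_hom, Category.assoc, tensor_X, braiding_hom_hom]

/-! ### The bialgebra structure on the bosonization -/

/-- The object `A ⊗ B` of `C` underlying the bosonization `A ⋉ B`. It is a separate definition so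
that the tensor product instances for `A ⊗ B.X` do not apply to it. -/
def bosonization (A : C) [BimonObj A] (B : CrossedModule A) : C := A ⊗ B.X

noncomputable section
variable (A : C) [HopfObj A] [IsIso 𝒮[A]] (B : CrossedModule A)

instance [MonObj B] : MonObj (bosonization A B) := underlyingMonObj (ad A ⊗ B)
instance [ComonObj B] : ComonObj (bosonization A B) := underlyingComonObj (coad A ⊗ B)

namespace bosonization

section
variable [MonObj B]

/-- The inclusion `a ↦ a ⊗ 1`. -/
def inlA : A ⟶ bosonization A B := (inl (ad A) B).hom
/-- The inclusion `b ↦ 1 ⊗ b`. -/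
def inrB : B.X ⟶ bosonization A B := (inr (ad A) B).hom

instance : IsMonHom (inlA A B) := isMonHom_underlying (inl (ad A) B)

lemma isMonHom_inrB : letI := underlyingMonObj B; IsMonHom (inrB A B) :=
  isMonHom_underlying (inr (ad A) B)

lemma inlA_mul_inrB : (inlA A B ⊗ₘ inrB A B) ≫ μ = 𝟙 (A ⊗ B.X) :=
  congrArg Hom.hom (inl_mul_inr (ad A) B)

/-- In elements: `b a = a₁ (b ◁ a₂)`. -/
lemma inrB_mul_inlA : (inrB A B ⊗ₘ inlA A B) ≫ μ = braid B (ad A) :=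
  congrArg Hom.hom (inr_mul_inl (ad A) B)

/-- The coaction of `A` on the crossed module `A_ad ⊗ B`. -/
def coaction : bosonization A B ⟶ bosonization A B ⊗ A := (ad A ⊗ B).coact

instance : IsMonHom (coaction A B) := isMonHom_coact (ad A ⊗ B)

/-- The coaction of `A` on `A_ad ⊗ B`, with its second component included into `A ⋉ B`. -/
def coactionInl : bosonization A B ⟶ bosonization A B ⊗ bosonization A B :=
  coaction A B ≫ bosonization A B ◁ inlA A B

instance : IsMonHom (coactionInl A B) :=
  inferInstanceAs (IsMonHom (coaction A B ≫ bosonization A B ◁ inlA A B))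

/-- The inclusion of `B` into the second factor of `(A ⋉ B) ⊗ (A ⋉ B)`. -/
def inrB₂ : B.X ⟶ bosonization A B ⊗ bosonization A B := inrB A B ≫ inr _ _

lemma isMonHom_inrB₂ : letI := underlyingMonObj B; IsMonHom (inrB₂ A B) :=
  let := underlyingMonObj B
  have := isMonHom_inrB A B
  inferInstanceAs (IsMonHom (inrB A B ≫ inr _ _))

lemma coactionInl_mul_inrB₂ : (coactionInl A B ⊗ₘ inrB₂ A B) ≫ μ =
    coaction A B ▷ B.X ≫ (α_ (bosonization A B) A B.X).hom :=
  (comp_mul_inr (coaction A B) (inlA A B) (inrB A B)).trans (by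
    rw [inlA_mul_inrB]
    exact congrArg (fun f => _ ≫ f) ((congrArg (_ ≫ ·) (whiskerLeft_id _ _)).trans
      (Category.comp_id _)))

/-- The monoid morphisms `coactionInl` and `inrB₂` commute up to the braiding of crossed modules. -/
lemma inrB₂_mul_coactionInl : (inrB₂ A B ⊗ₘ coactionInl A B) ≫ μ =
    braid B (ad A ⊗ B) ≫ (coactionInl A B ⊗ₘ inrB₂ A B) ≫ μ := by
  refine (inr_mul_comp (coaction A B) (inlA A B) (inrB A B)).trans ?_
  refine Eq.trans ?_ (congrArg (braid B (ad A ⊗ B) ≫ ·) (coactionInl_mul_inrB₂ A B)).symm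
  refine Eq.trans ?_ (braid_coact B (ad A ⊗ B)).symm
  rw [inrB_mul_inlA]
  rfl

lemma isMonHom_coactionInl_mul_inrB₂ :
    letI := underlyingMonObj ((ad A ⊗ B) ⊗ B)
    IsMonHom (M := ((ad A ⊗ B) ⊗ B).X) ((coactionInl A B ⊗ₘ inrB₂ A B) ≫ μ) :=
  isMonHom_tensor_of_braid (X := ad A ⊗ B) (inferInstanceAs (IsMonHom (coactionInl A B)))
    (isMonHom_inrB₂ A B) (inrB₂_mul_coactionInl A B)

end

section
variable [BimonObj B]

/-- In elements: `Δ(a ⊗ b) = δ(a ⊗ b₁) (1 ⊗ (1 ⊗ b₂))`, where `δ` is `coactionInl`. -/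
lemma comul_eq : Δ[bosonization A B] = (ad A ◁ Δ[B] ≫ (α_ (ad A) B B).inv).hom ≫
    (coactionInl A B ⊗ₘ inrB₂ A B) ≫ μ := by
  refine Eq.trans ?_ (congrArg ((ad A ◁ Δ[B] ≫ (α_ (ad A) B B).inv).hom ≫ ·)
    (coactionInl_mul_inrB₂ A B)).symm
  change (Δ[coad A ⊗ B]).hom = _ ≫ tensorCoact (ad A) B ▷ B.X ≫ (α_ (A ⊗ B.X) A B.X).hom
  have h : (ad A ◁ Δ[B] ≫ (α_ (ad A) B B).inv).hom = A ◁ Δ[B].hom ≫ (α_ A B.X B.X).inv := by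
    simp only [comp_hom, whiskerLeft_hom, associator_inv_hom]
  rw [Comon.tensorObj_comul, h]
  change (Δ[A] ⊗ₘ Δ[B].hom) ≫ (tensorμ (coad A) (coad A) B B).hom =
    (A ◁ Δ[B].hom ≫ (α_ A B.X B.X).inv) ≫ tensorCoact (ad A) B ▷ B.X ≫ (α_ (A ⊗ B.X) A B.X).hom
  have : (tensorμ (coad A) (coad A) B B).hom = (α_ A A (B.X ⊗ B.X)).hom ≫
      A ◁ (α_ A B.X B.X).inv ≫ A ◁ (A ◁ B.coact ≫ (α_ A B.X A).inv ≫ (β_ A B.X).hom ▷ A ≫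
        (α_ B.X A A).hom ≫ B.X ◁ μ) ▷ B.X ≫ A ◁ (α_ B.X A B.X).hom ≫
      (α_ A B.X (A ⊗ B.X)).inv := by
    simp only [tensorμ, comp_hom, associator_hom_hom, associator_inv_hom, whiskerLeft_hom,
      whiskerRight_hom, braiding_hom_hom, braid]
    rfl
  rw [this, tensorCoact, MonoidalCategory.tensorHom_def', MonoidalCategory.tensorHom_def Δ[A]]
  simp only [tensorμ]
  monoidal

lemma isMonHom_comul : IsMonHom Δ[bosonization A B] := by
  let := underlyingMonObj ((ad A ⊗ B) ⊗ B)
  have h₁ : IsMonHom (M := bosonization A B) (N := ((ad A ⊗ B) ⊗ B).X)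
      (ad A ◁ Δ[B] ≫ (α_ (ad A) B B).inv).hom :=
    isMonHom_underlying (ad A ◁ Δ[B] ≫ (α_ (ad A) B B).inv)
  have h₂ := isMonHom_coactionInl_mul_inrB₂ A B
  rw [comul_eq]
  exact instIsMonHomComp (M := bosonization A B) (N := ((ad A ⊗ B) ⊗ B).X) _ _

lemma isMonHom_counit : IsMonHom ε[bosonization A B] := by
  have hB : letI := underlyingMonObj B; IsMonHom (N := 𝟙_ C) ε[B].hom :=
    let := underlyingMonObj B
    ⟨congrArg Hom.hom (IsMonHom.one_hom ε[B]), congrArg Hom.hom (IsMonHom.mul_hom ε[B])⟩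
  have h := isMonHom_tensor_of_braid (X := ad A) (Y := B) (K := 𝟙_ C) (f := ε[A]) (g := ε[B].hom)
    (inferInstanceAs (IsMonHom ε[A])) hB ?_
  · exact h
  -- `ε[A]` is not a morphism of crossed modules on `A_ad`, but `ε[B]` is one on `B`, so that
  -- naturality reduces the commutation to the braiding with the unit object.
  · have n : ε[B].hom ▷ A ≫ braid (𝟙_ _) (ad A) = braid B (ad A) ≫ A ◁ ε[B].hom :=
      braid_natural_left ε[B] (ad A)
    have u : braid (𝟙_ _) (ad A) = (λ_ A).hom ≫ (ρ_ A).inv := by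
      change 𝟙_ C ◁ Δ[A] ≫ (α_ (𝟙_ C) A A).inv ≫ (β_ (𝟙_ C) A).hom ▷ A ≫ (α_ A (𝟙_ C) A).hom ≫
        A ◁ ((λ_ A).hom ≫ ε[A]) = _
      have : A ◁ ((λ_ A).hom ≫ ε[A]) = (α_ _ _ _).inv ≫ (ρ_ A).hom ▷ A ≫ A ◁ ε[A] := by simp
      rw [this, braiding_tensorUnit_left]
      simp [comul_counit]
    change (ε[B].hom ⊗ₘ ε[A]) ≫ (λ_ (𝟙_ C)).hom = braid B (ad A) ≫ (ε[A] ⊗ₘ ε[B].hom) ≫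
      (λ_ (𝟙_ C)).hom
    rw [MonoidalCategory.tensorHom_def' ε[A], Category.assoc]
    refine Eq.trans ?_ (as22 n _)
    rw [u, MonoidalCategory.tensorHom_def]
    simp [← unitors_inv_equal]

instance : BimonObj (bosonization A B) where
  one_comul := (isMonHom_comul A B).one_hom
  mul_comul := by simpa [tensorObj.mul_def] using (isMonHom_comul A B).mul_hom
  one_counit := (isMonHom_counit A B).one_hom
  mul_counit := (isMonHom_counit A B).mul_hom

end

/-! ### The antipode of the bosonization -/

section
variable [ComonObj B]

/-- The projection `a ⊗ b ↦ a ε(b)`. -/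
def fstA : bosonization A B ⟶ A := (fst (coad A) B).hom
/-- The projection `a ⊗ b ↦ ε(a) b`. -/
def sndB : bosonization A B ⟶ B.X := (snd (coad A) B).hom

instance : IsComonHom (fstA A B) := isComonHom_underlying (fst (coad A) B)

lemma isComonHom_sndB : letI := underlyingComonObj B; IsComonHom (sndB A B) :=
  isComonHom_underlying (snd (coad A) B)

lemma comul_fstA_sndB : Δ ≫ (fstA A B ⊗ₘ sndB A B) = 𝟙 (A ⊗ B.X) :=
  congrArg Hom.hom (comul_fst_snd (coad A) B)

lemma comul_sndB_fstA : Δ ≫ (sndB A B ⊗ₘ fstA A B) = braid (coad A) B :=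
  congrArg Hom.hom (comul_snd_fst (coad A) B)

end

variable [HopfObj B]

/-- The antipode of the bosonization. -/
def antipodeHom : bosonization A B ⟶ bosonization A B :=
  braid (coad A) B ≫ (𝒮[B].hom ⊗ₘ 𝒮[A]) ≫ braid B (ad A)

lemma toConv_antipodeHom :
    toConv (antipodeHom A B) =
      toConv (sndB A B ≫ 𝒮[B].hom ≫ inrB A B) * toConv (fstA A B ≫ 𝒮[A] ≫ inlA A B) := by
  rw [toConv_mul, antipodeHom, ← comul_sndB_fstA, ← inrB_mul_inlA]
  refine congrArg toConv ?_
  simp only [Category.assoc, tensorHom_comp_tensorHom_assoc]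

lemma toConv_id :
    toConv (𝟙 (bosonization A B)) =
      toConv (fstA A B ≫ 𝟙 A ≫ inlA A B) * toConv (sndB A B ≫ 𝟙 B.X ≫ inrB A B) := by
  rw [toConv_mul]
  refine congrArg toConv ?_
  simp only [Category.id_comp]
  rw [← tensorHom_comp_tensorHom_assoc, inlA_mul_inrB]
  exact ((congrArg (Δ ≫ ·) (Category.comp_id (fstA A B ⊗ₘ sndB A B))).trans
    (comul_fstA_sndB A B)).symm

lemma conv_A_left :
    toConv (fstA A B ≫ 𝒮[A] ≫ inlA A B) * toConv (fstA A B ≫ 𝟙 A ≫ inlA A B) = 1 :=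
  conv_inverse _ _ (by simp)

lemma conv_A_right :
    toConv (fstA A B ≫ 𝟙 A ≫ inlA A B) * toConv (fstA A B ≫ 𝒮[A] ≫ inlA A B) = 1 :=
  conv_inverse _ _ (by simp)

lemma conv_B_left :
    toConv (sndB A B ≫ 𝒮[B].hom ≫ inrB A B) * toConv (sndB A B ≫ 𝟙 B.X ≫ inrB A B) = 1 :=
  let := underlyingMonObj B
  let := underlyingComonObj B
  have := isMonHom_inrB A B
  have := isComonHom_sndB A B
  conv_inverse _ _ (by
    rw [tensorHom_id]
    have h := congrArg Hom.hom (HopfObj.antipode_left B)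
    simp only [comp_hom, whiskerRight_hom] at h
    exact h)

lemma conv_B_right :
    toConv (sndB A B ≫ 𝟙 B.X ≫ inrB A B) * toConv (sndB A B ≫ 𝒮[B].hom ≫ inrB A B) = 1 :=
  let := underlyingMonObj B
  let := underlyingComonObj B
  have := isMonHom_inrB A B
  have := isComonHom_sndB A B
  conv_inverse _ _ (by
    rw [id_tensorHom]
    have h := congrArg Hom.hom (HopfObj.antipode_right B)
    simp only [comp_hom, whiskerLeft_hom] at h
    exact h)

instance : HopfObj (bosonization A B) where
  antipode := antipodeHom A B
  antipode_left := by
    have h : toConv (antipodeHom A B) * toConv (𝟙 (bosonization A B)) = 1 := by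
      rw [toConv_antipodeHom, toConv_id, _root_.mul_assoc,
        ← _root_.mul_assoc (toConv (fstA A B ≫ _)),
        conv_A_left, _root_.one_mul, conv_B_left]
    rw [toConv_mul, tensorHom_id] at h
    exact h
  antipode_right := by
    have h : toConv (𝟙 (bosonization A B)) * toConv (antipodeHom A B) = 1 := by
      rw [toConv_antipodeHom, toConv_id, _root_.mul_assoc,
        ← _root_.mul_assoc (toConv (sndB A B ≫ _)),
        conv_B_right, _root_.one_mul, conv_A_right]
    rw [toConv_mul, id_tensorHom] at h
    exact h

end bosonization
end
end CrossedModule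

theorem mainTheorem2 {C : Type u} [Category.{v} C] [MonoidalCategory C] [BraidedCategory C]
    (A : C) [HopfObj A] [IsIso 𝒮[A]] (B : CrossedModule A) [HopfObj B] [IsIso 𝒮[B]] :
    ∃ h : HopfObj (A ⊗ B.X),
      h.toMonObj = CrossedModule.underlyingMonObj (CrossedModule.ad A ⊗ B) ∧
      h.toComonObj = CrossedModule.underlyingComonObj (CrossedModule.coad A ⊗ B) ∧
      h.antipode = (β_ (CrossedModule.coad A) B).hom.hom ≫ (𝒮[B].hom ⊗ₘ 𝒮[A]) ≫
        (β_ B (CrossedModule.ad A)).hom.hom ∧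
      IsIso h.antipode := by
  refine ⟨inferInstanceAs (HopfObj (CrossedModule.bosonization A B)), rfl, rfl, rfl, ?_⟩
  have hS : IsIso 𝒮[B].hom :=
    ⟨(inv 𝒮[B]).hom, congrArg CrossedModule.Hom.hom (IsIso.hom_inv_id 𝒮[B]),
      congrArg CrossedModule.Hom.hom (IsIso.inv_hom_id 𝒮[B])⟩
  change IsIso ((CrossedModule.braidIso (CrossedModule.coad A) B).hom ≫ (𝒮[B].hom ⊗ₘ 𝒮[A]) ≫
    (CrossedModule.braidIso B (CrossedModule.ad A)).hom)
  infer_instance
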